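/- **Notation.** Let $K$ be a normed field of characteristic $0$ (for instance $\mathbb C$, or formal Laurent series over $\mathbb Q$ in $q$) and let $q\in K$ with $|q|<1$. Write $(a;q)_k=(1-a)(1-aq)\cdots(1-aq^{k-1})$ and $(q)_k=(q;q)_k$. For a partition $\lambda=(\lambda_1\ge\lambda_2\ge\cdots)$ let $\lambda'$ be its conjugate and $l(\lambda)$ its number of nonzero parts. For $N\ge l(\lambda)$ and $t \in K$ with $|t|<1$, the Hall–Littlewood polynomial is $$P_\lambda(x_1,\dots,x_N;t)=\prod_{i\ge 0}\frac{(1-t)^{m_i}}{(t;t)_{m_i}}\sum_{w\in\mathfrak S_N}w\Bigl(x_1^{\lambda_1}\cdots x_N^{\lambda_N}\prod_{1\le i<j\le N}\frac{x_i-tx_j}{x_i-x_j}\Bigr),$$ where $m_i$ is the number of times $i$ occurs among $\lambda_1,\dots,\lambda_N$ (so $m_0=N-l(\lambda)$), and $\mathfrak S_N$ permutes the $x_i$. The symmetric function $P_\lambda(x_1,x_2,\dots;t)$ in countably many variables is the polynomial in the power sums $p_r$ ($r\ge1$), with coefficients in $K$, that becomes $P_\lambda(x_1,\dots,x_N;t)$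 for every $N\ge l(\lambda)$ when each $p_r$ is read as $x_1^r+\cdots+x_N^r$. Its value $P_\lambda(1,q,q^2,\dots;t)$ is obtained by putting $p_r=\sum_{i\ge0}(q^i)^r$ for every $r$. **Lemma.** Let $m,n$ be positive integers and let $\lambda$ be a partition with $\lambda_1\le m$. Then the symmetric function $P_\lambda(x_1,x_2,\dots;q^n)$ exists, and $$P_\lambda(1,q,q^2,\dots;q^n)=\sum_{s}\mathcal B_{m,n}(s;q^n)\,q^{\mathcal A_{m,n}(s)}.$$ The (finite) sum ranges over all arrays of integers $s_i^{(j)}$ ($1\le i\le m$, $1\le j\le n-1$) that, together with the fixed values $s_i^{(0)}=\lambda'_i$, $s_i^{(n)}=0$ for all $i$, and $s_{m+1}^{(j)}=0$ for all $j$, satisfy $$s_1^{(j)}\ge s_2^{(j)}\ge\cdots\ge s_m^{(j)}\ (0\le j\le n-1),\qquad s_i^{(j)}\ge s_i^{(j+1)}\ (1\le i\le m,\ 0\le j\le n-1).$$ Here, with $s^{(j)}=s_1^{(j)}+\cdots+s_m^{(j)}$, $$\mathcal A_{m,n}(s)=-\frac n2 s^{(0)}+s^{(1)}+\cdots+s^{(n-1)}+\frac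 n2\sum_{i=1}^m\sum_{a=1}^n\bigl(s_i^{(a-1)}-s_i^{(a)}\bigr)^2,$$ which is a non-negative integer, and $$\mathcal B_{m,n}(s;q)=\prod_{i=1}^m\prod_{a=1}^n\frac{(q)_{s_i^{(a-1)}-s_{i+1}^{(a)}}}{(q)_{s_i^{(a-1)}-s_i^{(a)}}\,(q)_{s_i^{(a)}-s_{i+1}^{(a)}}}\ \prod_{i=1}^m\frac1{(q)_{s_i^{(0)}-s_{i+1}^{(0)}}}.$$ -/

import Mathlib

namespace HLPrincipal

/-- The `q`-Pochhammer symbol `(a; q)_k = (1 - a)(1 - a q) ⋯ (1 - a q^(k-1))`. -/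
def qPoch {K : Type*} [Field K] (a q : K) (k : ℕ) : K :=
  ∏ i ∈ Finset.range k, (1 - a * q ^ i)

/-- The number of times `i` occurs among `lam_1, …, lam_N`. For `i ≥ 1` and `l(lam) ≤ N` this is
the multiplicity `m_i(lam)`, and for `i = 0` it is `m_0 = N - l(lam)`.
Partitions are Young diagrams: `lam.rowLen k` is the part `lam_{k+1}`, `lam.colLen k` is the
conjugate part `lam'_{k+1}`, and `lam.colLen 0` is the length `l(lam)`. -/
def mult (lam : YoungDiagram) (N i : ℕ) : ℕ :=
  (Finset.univ.filter fun k : Fin N => lam.rowLen k = i).card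

/-- The Hall-Littlewood expression in `N` elements `x_1, …, x_N` of a field,
`∏_{i ≥ 0} (1-t)^{m_i} / (t;t)_{m_i} · ∑_w w(x_1^{lam_1} ⋯ x_N^{lam_N} ∏_{i<j} (x_i - t x_j)/(x_i - x_j))`.
The product over `i` may stop at the largest part, since `m_i = 0` beyond it. -/
noncomputable def hallLittlewood {L : Type*} [Field L] (lam : YoungDiagram) {N : ℕ}
    (x : Fin N → L) (t : L) : L :=
  (∏ i ∈ Finset.range (lam.rowLen 0 + 1), (1 - t) ^ mult lam N i / qPoch t t (mult lam N i)) *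
    ∑ w : Equiv.Perm (Fin N),
      (∏ k : Fin N, x (w k) ^ lam.rowLen k) *
        ∏ i : Fin N, ∏ j ∈ Finset.Ioi i, (x (w i) - t * x (w j)) / (x (w i) - x (w j))

/-- Symmetric functions in countably many variables over a field `K` of characteristic zero are
polynomials in the power sums: the variable `X r` of `MvPolynomial ℕ K` stands for `p_{r+1}`.
`restrict N F` is the symmetric polynomial in `x_1, …, x_N` obtained by
reading `p_r` as `x_1^r + ⋯ + x_N^r`. -/
noncomputable def restrict {K : Type*} [Field K] (N : ℕ) (F : MvPolynomial ℕ K) :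
    MvPolynomial (Fin N) K :=
  MvPolynomial.aeval (fun r : ℕ => MvPolynomial.psum (Fin N) K (r + 1)) F

/-- The value of a symmetric function at a sequence `x_1, x_2, …`: every power sum `p_r` is
replaced by `x_1^r + x_2^r + ⋯`. -/
noncomputable def evalSeq {K : Type*} [NormedField K] (x : ℕ → K) (F : MvPolynomial ℕ K) : K :=
  MvPolynomial.eval (fun r : ℕ => ∑' i : ℕ, x i ^ (r + 1)) F

/-- `F` is the Hall-Littlewood symmetric function of `lam` with parameter `t`: for every
`N ≥ l(lam)`, its restriction to `N` variables is, in the field of rational functions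
`K(x_1, …, x_N)`, the Hall-Littlewood expression in the indeterminates `x_1, …, x_N`. -/
def IsHallLittlewood {K : Type*} [Field K] (lam : YoungDiagram) (t : K)
    (F : MvPolynomial ℕ K) : Prop :=
  ∀ N : ℕ, lam.colLen 0 ≤ N →
    algebraMap (MvPolynomial (Fin N) K) (FractionRing (MvPolynomial (Fin N) K)) (restrict N F) =
      hallLittlewood lam
        (fun k : Fin N => algebraMap (MvPolynomial (Fin N) K)
          (FractionRing (MvPolynomial (Fin N) K)) (MvPolynomial.X k))
        (algebraMap (MvPolynomial (Fin N) K)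
          (FractionRing (MvPolynomial (Fin N) K)) (MvPolynomial.C t))

/-- The Hall-Littlewood symmetric function `P_lam(x_1, x_2, … ; t)` in countably many variables. -/
noncomputable def hallLittlewoodSymm {K : Type*} [Field K] (lam : YoungDiagram) (t : K) :
    MvPolynomial ℕ K :=
  Classical.epsilon (IsHallLittlewood lam t)

/-- The arrays of non-negative integers over which the sum ranges, with the conventional boundary
values included: `s j i` is `s_{i+1}^{(j)}`, with `s^{(0)} = lam'`, `s_i^{(n)} = 0`,
`s_{m+1}^{(j)} = 0`, `s_i^{(j)} ≥ s_{i+1}^{(j)}` and `s_i^{(j)} ≥ s_i^{(j+1)}`.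
So all entries with `j ≥ n` or `i ≥ m` vanish, and the free ones have `1 ≤ j ≤ n-1`, `i < m`. -/
def indexArrays (lam : YoungDiagram) (m n : ℕ) : Set (ℕ → ℕ → ℕ) :=
  {s | (∀ i, s 0 i = lam.colLen i) ∧ (∀ i, s n i = 0) ∧ (∀ j, s j m = 0) ∧
    (∀ j i, s j (i + 1) ≤ s j i) ∧ (∀ j i, s (j + 1) i ≤ s j i)}

theorem indexArrays_finite (lam : YoungDiagram) (m n : ℕ) : (indexArrays lam m n).Finite := by
  classical
  let T : Set (Fin n → Fin m → Fin (lam.colLen 0 + 1)) := Set.univ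
  let f : (Fin n → Fin m → Fin (lam.colLen 0 + 1)) → ℕ → ℕ → ℕ := fun g j i =>
    if h : j < n ∧ i < m then (g ⟨j, h.1⟩ ⟨i, h.2⟩ : ℕ) else 0
  refine ((Set.toFinite T).image f).subset ?_
  rintro s ⟨h0, hn, hm, hi, hj⟩
  have ai : ∀ j, Antitone (s j) := fun j => antitone_nat_of_succ_le (hi j)
  have aj : ∀ i, Antitone (fun j => s j i) := fun i => antitone_nat_of_succ_le (fun j => hj j i)
  have hb : ∀ j i, s j i < lam.colLen 0 + 1 := fun j i => by
    have h1 : s j i ≤ s j 0 := ai j (Nat.zero_le i)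
    have h2 : s j 0 ≤ s 0 0 := aj 0 (Nat.zero_le j)
    have h3 := h0 0
    omega
  refine ⟨fun j i => ⟨s j i, hb j i⟩, Set.mem_univ _, ?_⟩
  funext j i
  by_cases h : j < n ∧ i < m
  · simp [f, h]
  · simp only [f, h, dite_false]
    by_cases hjn : j < n
    · have hmi : m ≤ i := by
        by_contra hc
        exact h ⟨hjn, by omega⟩
      have h1 : s j i ≤ s j m := ai j hmi
      have h2 := hm j
      omega
    · have h1 : s j i ≤ s n i := aj i (by omega)
      have h2 := hn i
      omega

/-- The set of index arrays as a finite set. -/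
noncomputable def arrays (lam : YoungDiagram) (m n : ℕ) : Finset (ℕ → ℕ → ℕ) :=
  (indexArrays_finite lam m n).toFinset

/-- `A_{m,n}(s) = -(n/2) s^{(0)} + s^{(1)} + ⋯ + s^{(n-1)}
  + (n/2) ∑_{i=1}^m ∑_{a=1}^n (s_i^{(a-1)} - s_i^{(a)})^2`, where `s^{(j)} = ∑_{i=1}^m s_i^{(j)}`. -/
def expA (m n : ℕ) (s : ℕ → ℕ → ℕ) : ℚ :=
  -((n : ℚ) / 2) * ∑ i ∈ Finset.range m, (s 0 i : ℚ)
    + ∑ j ∈ Finset.Ico 1 n, ∑ i ∈ Finset.range m, (s j i : ℚ)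
    + ((n : ℚ) / 2) *
      ∑ i ∈ Finset.range m, ∑ a ∈ Finset.range n, ((s a i : ℚ) - (s (a + 1) i : ℚ)) ^ 2

/-- `B_{m,n}(s;q) = ∏_{i=1}^m ∏_{a=1}^n (q)_{s_i^{(a-1)} - s_{i+1}^{(a)}} /
  ((q)_{s_i^{(a-1)} - s_i^{(a)}} (q)_{s_i^{(a)} - s_{i+1}^{(a)}})
  · ∏_{i=1}^m 1 / (q)_{s_i^{(0)} - s_{i+1}^{(0)}}`.
On index arrays none of the subtractions truncates. -/
def coeffB {K : Type*} [Field K] (m n : ℕ) (s : ℕ → ℕ → ℕ) (q : K) : K :=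
  (∏ i ∈ Finset.range m, ∏ a ∈ Finset.range n,
    qPoch q q (s a i - s (a + 1) (i + 1)) /
      (qPoch q q (s a i - s (a + 1) i) * qPoch q q (s (a + 1) i - s (a + 1) (i + 1)))) *
  ∏ i ∈ Finset.range m, 1 / qPoch q q (s 0 i - s 0 (i + 1))

theorem sum_telescope (f : ℕ → ℚ) (n : ℕ) (hn : 0 < n) :
    ∑ a ∈ Finset.range n, (a : ℚ) * (f a - f (a + 1)) =
      ∑ j ∈ Finset.Ico 1 n, f j - ((n : ℚ) - 1) * f n := by
  induction n, hn using Nat.le_induction with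
  | base => simp
  | succ n hn ih =>
    rw [Finset.sum_range_succ, ih, Finset.sum_Ico_succ_top hn]
    push_cast
    ring

/-- On index arrays, `A_{m,n}(s)` is a non-negative integer,
so that `⌊A_{m,n}(s)⌋₊` is `A_{m,n}(s)` itself. -/
theorem natFloor_expA {lam : YoungDiagram} {m n : ℕ} {s : ℕ → ℕ → ℕ}
    (hs : s ∈ arrays lam m n) : ((⌊expA m n s⌋₊ : ℕ) : ℚ) = expA m n s := by
  obtain ⟨h0, hn, hm, hi, hj⟩ : s ∈ indexArrays lam m n := by simpa [arrays] using hs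
  suffices h : ∃ k : ℕ, expA m n s = k by
    obtain ⟨k, hk⟩ := h
    rw [hk, Nat.floor_natCast]
  rcases Nat.eq_zero_or_pos n with rfl | hpos
  · exact ⟨0, by simp [expA]⟩
  refine ⟨∑ i ∈ Finset.range m, ∑ a ∈ Finset.range n,
    (a * (s a i - s (a + 1) i) + n * (s a i - s (a + 1) i).choose 2), ?_⟩
  have key : ∀ i, ∑ a ∈ Finset.range n, ((a * (s a i - s (a + 1) i) +
      n * (s a i - s (a + 1) i).choose 2 : ℕ) : ℚ) =
      -((n : ℚ) / 2) * s 0 i + ∑ j ∈ Finset.Ico 1 n, (s j i : ℚ) +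
        ((n : ℚ) / 2) * ∑ a ∈ Finset.range n, ((s a i : ℚ) - (s (a + 1) i : ℚ)) ^ 2 := by
    intro i
    have e1 : ∀ a, ((a * (s a i - s (a + 1) i) + n * (s a i - s (a + 1) i).choose 2 : ℕ) : ℚ) =
        (a : ℚ) * ((s a i : ℚ) - s (a + 1) i) - ((n : ℚ) / 2) * ((s a i : ℚ) - s (a + 1) i) +
          ((n : ℚ) / 2) * ((s a i : ℚ) - s (a + 1) i) ^ 2 := by
      intro a
      rw [Nat.cast_add, Nat.cast_mul, Nat.cast_mul, Nat.cast_choose_two, Nat.cast_sub (hj a i)]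
      ring
    rw [Finset.sum_congr rfl fun a _ => e1 a, Finset.sum_add_distrib, Finset.sum_sub_distrib,
      ← Finset.mul_sum, ← Finset.mul_sum, sum_telescope (fun a => (s a i : ℚ)) n hpos,
      Finset.sum_range_sub' (fun a => (s a i : ℚ)), hn i]
    push_cast
    ring
  rw [Nat.cast_sum, Finset.sum_congr rfl fun i _ => (Nat.cast_sum _ _).trans (key i),
    Finset.sum_add_distrib, Finset.sum_add_distrib, ← Finset.mul_sum, ← Finset.mul_sum,
    expA, Finset.sum_comm (s := Finset.Ico 1 n)]

end HLPrincipal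

namespace HLPrincipal

/-! Write `t = q^n`. Two facts about Jing's operators B_m carry the proof. With Q(z) = ∑ q_r z^r =
exp(∑ (1 - t^r) p_r z^r / r), the operator B_m removes a variable z from the alphabet of F and then
replaces each z^k by q_{m+k}.

The first fact is that B_{λ_1} B_{λ_2} ⋯ 1 is P_λ up to a scalar. In finitely many variables,
partial fractions of ∏ (1 - t x_j z)/(1 - x_j z) turn B_m with m > 0 into (1 - t) ∑_i x_i^m ∏_{j≠i}
(x_i - t x_j)/(x_i - x_j) · F(x without x_i). This is the recursion obtained by sorting the sum over
permutations by the image of the first index (`pow_mul_hlSum`). The scalar left after normalization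
does not depend on N, which proves existence.

The second fact is a branching rule. Let T_y add the variables y, ty, t²y, … to the alphabet. Since
Q(z) is thereby multiplied by 1/(1 - yz), T_y B_{m+1} = B_{m+1} T_y + y T_y B_m. Together with B_m
B_{m+1} = t B_{m+1} B_m (`jing_comm`), a q-binomial theorem gives T_y B_{m+1}^a as a sum over j of
y^j t^(j choose 2) [a choose j] B_{m+1}^{a-j} T_y B_m^j. Applied from the longest rows to the
shortest, this expands T_y P_λ over all partitions inside λ, with an explicit product weight
(`addVar_columnQ`).

Finally 1, q, q², … is the union of the n progressions q^a, q^a t, q^a t², … for 0 ≤ a < n. Adding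
them one at a time to the empty alphabet gives a sum over flags of partitions from λ down to the
empty one. These flags, recorded by columns, are the arrays s, and their weights multiply to B(s)
q^{A(s)}. -/

/-- `G` is the formal exponential of the antiderivative of `A`. -/
def IsExpOf {S : Type*} [CommRing S] (A G : PowerSeries S) : Prop :=
  PowerSeries.constantCoeff G = 1 ∧ PowerSeries.derivative S G = A * G

/-- The geometric series `∑ a^k z^k`. -/
def geomSeries {S : Type*} [CommRing S] (a : S) : PowerSeries S := PowerSeries.mk fun k => a ^ k

/-! ### Power series determined by their logarithmic derivative. -/

section Series

variable {S : Type*} [CommRing S]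

theorem IsExpOf.one : IsExpOf (0 : PowerSeries S) 1 := by
  simp [IsExpOf]

theorem IsExpOf.mul {A B G H : PowerSeries S} (hG : IsExpOf A G) (hH : IsExpOf B H) :
    IsExpOf (A + B) (G * H) := by
  refine ⟨by rw [map_mul, hG.1, hH.1, one_mul], ?_⟩
  rw [Derivation.leibniz, hG.2, hH.2, smul_eq_mul, smul_eq_mul]
  ring

theorem IsExpOf.prod {ι : Type*} (s : Finset ι) {A G : ι → PowerSeries S}
    (h : ∀ i ∈ s, IsExpOf (A i) (G i)) : IsExpOf (∑ i ∈ s, A i) (∏ i ∈ s, G i) := by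
  classical
  induction s using Finset.induction_on with
  | empty => simpa using IsExpOf.one
  | insert i s hi ih =>
    rw [Finset.sum_insert hi, Finset.prod_insert hi]
    exact (h i (Finset.mem_insert_self _ _)).mul
      (ih fun j hj => h j (Finset.mem_insert_of_mem hj))

/-- Coefficient n of G' = A G expresses (n + 1) g_{n+1} through lower coefficients, and n + 1 can be
cancelled. Generating function identities below are proved by comparing logarithmic derivatives. -/
theorem IsExpOf.unique [IsDomain S] [CharZero S] {A G H : PowerSeries S}
    (hG : IsExpOf A G) (hH : IsExpOf A H) : G = H := by
  ext n
  induction n using Nat.strong_induction_on with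
  | _ n ih =>
    cases n with
    | zero => simpa using hG.1.trans hH.1.symm
    | succ n =>
      have h1 := congrArg (PowerSeries.coeff n) hG.2
      have h2 := congrArg (PowerSeries.coeff n) hH.2
      rw [PowerSeries.coeff_derivative, PowerSeries.coeff_mul] at h1 h2
      have h3 : ∑ p ∈ Finset.HasAntidiagonal.antidiagonal n, PowerSeries.coeff p.1 A * PowerSeries.coeff p.2 G =
          ∑ p ∈ Finset.HasAntidiagonal.antidiagonal n, PowerSeries.coeff p.1 A * PowerSeries.coeff p.2 H :=
        Finset.sum_congr rfl fun p hp => by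
          rw [ih p.2 (by have := Finset.HasAntidiagonal.mem_antidiagonal.1 hp; omega)]
      have h4 : ((n : S) + 1) ≠ 0 := by exact_mod_cast Nat.succ_ne_zero n
      exact mul_right_cancel₀ h4 (h1.trans (h3.trans h2.symm))

theorem one_sub_mul_geomSeries (a : S) :
    (1 - PowerSeries.C a * PowerSeries.X) * geomSeries a = 1 := by
  ext n
  rw [sub_mul, one_mul, mul_assoc, map_sub, PowerSeries.coeff_C_mul]
  cases n with
  | zero => simp [geomSeries]
  | succ n =>
    rw [PowerSeries.coeff_succ_X_mul]
    simp [geomSeries, PowerSeries.coeff_one, pow_succ']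

theorem derivative_one_sub (a : S) :
    PowerSeries.derivative S (1 - PowerSeries.C a * PowerSeries.X) = -PowerSeries.C a := by
  rw [map_sub, Derivation.leibniz, PowerSeries.derivative_C, PowerSeries.derivative_X]
  simp

theorem isExpOf_one_sub (a : S) :
    IsExpOf (-(PowerSeries.C a * geomSeries a)) (1 - PowerSeries.C a * PowerSeries.X) := by
  refine ⟨by simp, ?_⟩
  rw [derivative_one_sub, neg_mul, mul_assoc, mul_comm (geomSeries a), one_sub_mul_geomSeries,
    mul_one]

theorem isExpOf_geomSeries (a : S) : IsExpOf (PowerSeries.C a * geomSeries a) (geomSeries a) := by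
  refine ⟨by simp [geomSeries, ← PowerSeries.coeff_zero_eq_constantCoeff_apply], ?_⟩
  have h := congrArg (PowerSeries.derivative S) (one_sub_mul_geomSeries a)
  rw [Derivation.leibniz, derivative_one_sub, Derivation.map_one_eq_zero, smul_eq_mul,
    smul_eq_mul] at h
  have h2 := one_sub_mul_geomSeries a
  linear_combination geomSeries a * h - PowerSeries.derivative S (geomSeries a) * h2

theorem C_mul_geomSeries (a : S) :
    PowerSeries.C a * geomSeries a = PowerSeries.mk fun k => a ^ (k + 1) := by
  ext k
  simp [geomSeries, pow_succ']

end Series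

/-! ### The symmetric functions q_r. -/

section QFun

variable {K : Type*} [Field K]

/-- The symmetric functions `q_r` with `∑ q_r z^r = exp (∑ (1 - t^r) p_r z^r / r)`. -/
noncomputable def qFun (t : K) : ℕ → MvPolynomial ℕ K
  | 0 => 1
  | r + 1 => MvPolynomial.C ((r + 1 : K)⁻¹) *
      ∑ k : Fin (r + 1), MvPolynomial.C (1 - t ^ ((k : ℕ) + 1)) * MvPolynomial.X (k : ℕ) *
        qFun t (r - k)

theorem qFun_zero (t : K) : qFun t 0 = 1 := by rw [qFun]

/-- The recursion defining `qFun` is this differential equation read coefficient by coefficient. -/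
theorem isExpOf_qFun [CharZero K] (t : K) :
    IsExpOf (PowerSeries.mk fun k => MvPolynomial.C (1 - t ^ (k + 1)) * MvPolynomial.X k)
      (PowerSeries.mk (qFun t)) := by
  refine ⟨by simp [← PowerSeries.coeff_zero_eq_constantCoeff_apply, qFun_zero], ?_⟩
  ext1 r
  rw [PowerSeries.coeff_derivative, PowerSeries.coeff_mk, PowerSeries.coeff_mul,
    Finset.Nat.sum_antidiagonal_eq_sum_range_succ_mk, Finset.sum_range]
  simp only [PowerSeries.coeff_mk]
  rw [qFun, mul_comm, ← mul_assoc]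
  have h : ((r : K) + 1) ≠ 0 := by exact_mod_cast Nat.succ_ne_zero r
  have h2 : ((r : MvPolynomial ℕ K) + 1) * MvPolynomial.C ((r + 1 : K)⁻¹) = 1 := by
    rw [show ((r : MvPolynomial ℕ K) + 1) = MvPolynomial.C (r + 1 : K) by simp,
      ← map_mul, mul_inv_cancel₀ h, map_one]
  rw [h2, one_mul]

variable {S : Type*} [CommRing S] [Algebra K S]

theorem isExpOf_aeval_qFun [CharZero K] (t : K) (p : ℕ → S) :
    IsExpOf (PowerSeries.mk fun k => algebraMap K S (1 - t ^ (k + 1)) * p k)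
      (PowerSeries.mk fun r => MvPolynomial.aeval p (qFun t r)) := by
  have h := isExpOf_qFun t
  refine ⟨by simp [← PowerSeries.coeff_zero_eq_constantCoeff_apply, qFun_zero], ?_⟩
  ext1 r
  have h2 := congrArg (MvPolynomial.aeval p) (congrArg (PowerSeries.coeff r) h.2)
  rw [PowerSeries.coeff_derivative, PowerSeries.coeff_mul] at h2 ⊢
  simpa only [PowerSeries.coeff_mk, map_mul, map_sum, map_add, map_natCast, map_one,
    MvPolynomial.aeval_C, MvPolynomial.aeval_X] using h2

/-- The generating series of the values of `q_r` is determined by its logarithmic derivative. -/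
theorem mk_aeval_qFun_eq [CharZero K] [IsDomain S] [CharZero S] (t : K) (p : ℕ → S)
    {H : PowerSeries S}
    (hH : IsExpOf (PowerSeries.mk fun k => algebraMap K S (1 - t ^ (k + 1)) * p k) H) :
    (PowerSeries.mk fun r => MvPolynomial.aeval p (qFun t r)) = H :=
  (isExpOf_aeval_qFun t p).unique hH

end QFun

/-! ### Jing's operators and their commutation relations. -/

section Operators

variable {K : Type*} [Field K]

/-- The substitution `p_r ↦ p_r - z^r`, removing a variable `z` from the alphabet. -/
noncomputable def removeVar : MvPolynomial ℕ K →ₐ[K] Polynomial (MvPolynomial ℕ K) :=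
  MvPolynomial.aeval fun r => Polynomial.C (MvPolynomial.X r) - Polynomial.X ^ (r + 1)

/-- The linear map sending `z^k` to `q_{m+k}`. -/
noncomputable def pairQ (t : K) (m : ℕ) :
    Polynomial (MvPolynomial ℕ K) →ₗ[MvPolynomial ℕ K] MvPolynomial ℕ K :=
  Polynomial.lsum fun k => LinearMap.mulRight (MvPolynomial ℕ K) (qFun t (m + k))

/-- Jing's creation operator for Hall-Littlewood functions. -/
noncomputable def jing (t : K) (m : ℕ) : Module.End K (MvPolynomial ℕ K) :=
  (pairQ t m).restrictScalars K ∘ₗ removeVar.toLinearMap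

/-- The substitution `p_r ↦ p_r + y^r / (1 - t^r)`, adding `y, ty, t²y, …` to the alphabet. -/
noncomputable def addVar (t y : K) : MvPolynomial ℕ K →ₐ[K] MvPolynomial ℕ K :=
  MvPolynomial.aeval fun r =>
    MvPolynomial.X r + MvPolynomial.C (y ^ (r + 1) / (1 - t ^ (r + 1)))

theorem pairQ_apply (t : K) (m : ℕ) (P : Polynomial (MvPolynomial ℕ K)) :
    pairQ t m P = P.sum fun k f => f * qFun t (m + k) := rfl

theorem pairQ_eq_sum_range (t : K) (m : ℕ) (P : Polynomial (MvPolynomial ℕ K)) {N : ℕ}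
    (hN : P.natDegree < N) :
    pairQ t m P = ∑ k ∈ Finset.range N, P.coeff k * qFun t (m + k) := by
  rw [pairQ_apply]
  exact Polynomial.sum_over_range' _ (fun _ => zero_mul _) _ hN

theorem pairQ_mul_X_pow (t : K) (m j : ℕ) (P : Polynomial (MvPolynomial ℕ K)) :
    pairQ t m (P * Polynomial.X ^ j) = pairQ t (m + j) P := by
  induction P using Polynomial.induction_on' with
  | add p q hp hq => rw [add_mul, map_add, map_add, hp, hq]
  | monomial k a =>
    rw [Polynomial.monomial_mul_X_pow, pairQ_apply, pairQ_apply, Polynomial.sum_monomial_index,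
      Polynomial.sum_monomial_index, add_assoc, add_comm j] <;> simp

theorem jing_apply (t : K) (m : ℕ) (F : MvPolynomial ℕ K) :
    jing t m F = pairQ t m (removeVar F) := rfl

theorem jing_one (t : K) : jing t 0 1 = 1 := by
  rw [jing_apply, map_one, pairQ_apply, ← Polynomial.C_1, Polynomial.sum_C_index] <;>
    simp [qFun_zero]

/-- The added alphabet has (1 - t^r) p_r = y^r, so the generating series is multiplied by 1/(1 -
yz); clearing this denominator gives the recursion. -/
theorem addVar_qFun_succ [CharZero K] {t : K} (ht : ∀ r : ℕ, t ^ (r + 1) ≠ 1) (y : K) (r : ℕ) :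
    addVar t y (qFun t (r + 1)) =
      qFun t (r + 1) + MvPolynomial.C y * addVar t y (qFun t r) := by
  have h := mk_aeval_qFun_eq t (fun r => (MvPolynomial.X r : MvPolynomial ℕ K) +
    MvPolynomial.C (y ^ (r + 1) / (1 - t ^ (r + 1))))
    (H := PowerSeries.mk (qFun t) * geomSeries (MvPolynomial.C y)) (by
      convert (isExpOf_qFun t).mul (isExpOf_geomSeries (MvPolynomial.C y)) using 1
      rw [C_mul_geomSeries]
      ext1 k
      simp only [PowerSeries.coeff_mk, map_add, MvPolynomial.algebraMap_eq, mul_add]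
      rw [← map_mul, mul_div_cancel₀ _ (sub_ne_zero.2 (ht k).symm), map_pow])
  have h2 : (1 - PowerSeries.C (MvPolynomial.C y) * PowerSeries.X) *
      (PowerSeries.mk fun r => addVar t y (qFun t r)) = PowerSeries.mk (qFun t) := by
    have h3 : (PowerSeries.mk fun r => addVar t y (qFun t r)) =
      PowerSeries.mk (qFun t) * geomSeries (MvPolynomial.C y) := h
    rw [h3, mul_left_comm, one_sub_mul_geomSeries, mul_one]
  have h4 := congrArg (PowerSeries.coeff (r + 1)) h2
  rw [sub_mul, one_mul, mul_assoc, map_sub, PowerSeries.coeff_C_mul,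
    PowerSeries.coeff_succ_X_mul] at h4
  simp only [PowerSeries.coeff_mk] at h4
  linear_combination h4

theorem removeVar_addVar (t y : K) (F : MvPolynomial ℕ K) :
    removeVar (addVar t y F) = (removeVar F).map (addVar t y : MvPolynomial ℕ K →+* _) := by
  have : (removeVar.comp (addVar t y)) =
      (Polynomial.mapAlgHom (addVar t y)).comp removeVar := by
    ext r : 1
    simp [removeVar, addVar, MvPolynomial.algebraMap_eq]
    ring
  exact DFunLike.congr_fun this F

/-- Adding and removing variables are independent substitutions, so `addVar` acts on the
coefficients of `removeVar F`, and the extra term comes from q_{m+1+k} alone. -/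
theorem addVar_jing_succ [CharZero K] {t : K} (ht : ∀ r : ℕ, t ^ (r + 1) ≠ 1) (y : K) (m : ℕ)
    (F : MvPolynomial ℕ K) :
    addVar t y (jing t (m + 1) F) =
      jing t (m + 1) (addVar t y F) + MvPolynomial.C y * addVar t y (jing t m F) := by
  have hN : (removeVar F).natDegree < (removeVar F).natDegree + 1 := Nat.lt_succ_self _
  have hN' : (removeVar (addVar t y F)).natDegree < (removeVar F).natDegree + 1 := by
    rw [removeVar_addVar]
    exact Nat.lt_succ_of_le Polynomial.natDegree_map_le
  rw [jing_apply, jing_apply, jing_apply, pairQ_eq_sum_range _ _ _ hN,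
    pairQ_eq_sum_range _ _ _ hN, pairQ_eq_sum_range _ _ _ hN', map_sum, map_sum, Finset.mul_sum,
    ← Finset.sum_add_distrib]
  refine Finset.sum_congr rfl fun k _ => ?_
  rw [map_mul, map_mul, removeVar_addVar, Polynomial.coeff_map, add_right_comm,
    addVar_qFun_succ ht]
  simp only [RingHom.coe_coe]
  ring

/-- The coefficients of `(1 - z) / (1 - t z)`. -/
def commCoeff (t : K) : ℕ → K
  | 0 => 1
  | j + 1 => t ^ (j + 1) - t ^ j

/-- Removing z multiplies the generating series in u by (1 - zu)/(1 - tzu). -/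
theorem removeVar_qFun [CharZero K] (t : K) (r : ℕ) :
    removeVar (qFun t r) = ∑ j ∈ Finset.range (r + 1),
      Polynomial.C (MvPolynomial.C (commCoeff t j) * qFun t (r - j)) * Polynomial.X ^ j := by
  let z : Polynomial (MvPolynomial ℕ K) := Polynomial.X
  let τ : Polynomial (MvPolynomial ℕ K) := Polynomial.C (MvPolynomial.C t)
  have h : (PowerSeries.mk fun r => removeVar (qFun t r)) =
      PowerSeries.mk (fun r => Polynomial.C (qFun t r)) *
        ((1 - PowerSeries.C z * PowerSeries.X) * geomSeries (τ * z)) := by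
    refine mk_aeval_qFun_eq t _ ?_
    have h1 := isExpOf_aeval_qFun (S := Polynomial (MvPolynomial ℕ K)) t
      (fun r => Polynomial.C (MvPolynomial.X r))
    have h2 : (fun r => MvPolynomial.aeval (fun r => Polynomial.C (MvPolynomial.X r))
        (qFun t r)) = fun r => Polynomial.C (qFun t r) := by
      funext r
      have : (MvPolynomial.aeval (fun r => Polynomial.C (MvPolynomial.X r)) :
          MvPolynomial ℕ K →ₐ[K] Polynomial (MvPolynomial ℕ K)) =
          IsScalarTower.toAlgHom K (MvPolynomial ℕ K) (Polynomial (MvPolynomial ℕ K)) := by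
        ext r : 1
        simp [Polynomial.C_eq_algebraMap]
      rw [this]
      simp [Polynomial.C_eq_algebraMap]
    rw [h2] at h1
    convert h1.mul ((isExpOf_one_sub z).mul (isExpOf_geomSeries (τ * z))) using 1
    rw [C_mul_geomSeries, C_mul_geomSeries]
    ext1 k
    simp only [PowerSeries.coeff_mk, map_add, map_neg]
    have : algebraMap K (Polynomial (MvPolynomial ℕ K)) (1 - t ^ (k + 1)) = 1 - τ ^ (k + 1) := by
      rw [map_sub, map_one, map_pow]; rfl
    rw [this, mul_pow]
    ring
  have h3 : (1 - PowerSeries.C z * PowerSeries.X) * geomSeries (τ * z) =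
      PowerSeries.mk fun j => Polynomial.C (MvPolynomial.C (commCoeff t j)) * z ^ j := by
    ext1 j
    rw [sub_mul, one_mul, mul_assoc, map_sub, PowerSeries.coeff_C_mul]
    cases j with
    | zero => simp [geomSeries, commCoeff]
    | succ j =>
      rw [PowerSeries.coeff_succ_X_mul]
      simp only [geomSeries, PowerSeries.coeff_mk, commCoeff, map_sub, map_pow]
      change (τ * z) ^ (j + 1) - z * (τ * z) ^ j = (τ ^ (j + 1) - τ ^ j) * z ^ (j + 1)
      ring
  have h4 := congrArg (PowerSeries.coeff r) h
  rw [h3, mul_comm, PowerSeries.coeff_mul, Finset.Nat.sum_antidiagonal_eq_sum_range_succ_mk] at h4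
  simp only [PowerSeries.coeff_mk] at h4
  rw [h4]
  refine Finset.sum_congr rfl fun j _ => ?_
  rw [map_mul]
  ring

/-- The straightening quantity `∑_j γ_j q_{u+j} q_{v-j}`. -/
noncomputable def quadQ (t : K) (u v : ℕ) : MvPolynomial ℕ K :=
  ∑ j ∈ Finset.range (v + 1),
    MvPolynomial.C (commCoeff t j) * qFun t (v - j) * qFun t (u + j)

/-- From index 1 on, the coefficients of (1 - z)/(1 - tz) are geometric with ratio t, so the tails
cancel. What remains is antisymmetric in u and v, which is what `jing_comm` exploits. -/
theorem quadQ_succ_sub (t : K) (u v : ℕ) :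
    quadQ t u (v + 1) - MvPolynomial.C t * quadQ t (u + 1) v =
      qFun t u * qFun t (v + 1) - qFun t (u + 1) * qFun t v := by
  rw [quadQ, quadQ, Finset.sum_range_succ', Finset.sum_range_succ', Finset.sum_range_succ' _ v,
    mul_add, Finset.mul_sum]
  have h : ∑ j ∈ Finset.range v, MvPolynomial.C (commCoeff t (j + 1 + 1)) *
      qFun t (v + 1 - (j + 1 + 1)) * qFun t (u + (j + 1 + 1)) =
      ∑ j ∈ Finset.range v, MvPolynomial.C t * (MvPolynomial.C (commCoeff t (j + 1)) *
        qFun t (v - (j + 1)) * qFun t (u + 1 + (j + 1))) := by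
    refine Finset.sum_congr rfl fun j _ => ?_
    rw [show v + 1 - (j + 1 + 1) = v - (j + 1) by omega,
      show u + (j + 1 + 1) = u + 1 + (j + 1) by omega, ← mul_assoc, ← mul_assoc, ← map_mul]
    congr 3
    simp only [commCoeff]
    ring
  rw [h]
  simp [commCoeff]
  ring

/-- The substitution `p_r ↦ p_r - z₁^r - z₂^r`. -/
noncomputable def removeTwoVars :
    MvPolynomial ℕ K →ₐ[K] Polynomial (Polynomial (MvPolynomial ℕ K)) :=
  (Polynomial.mapAlgHom removeVar).comp removeVar

theorem coeff_coeff_removeTwoVars (F : MvPolynomial ℕ K) (k l : ℕ) :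
    ((removeTwoVars F).coeff l).coeff k = (removeVar ((removeVar F).coeff l)).coeff k := by
  simp [removeTwoVars]

theorem coeff_coeff_swap {A : Type*} [CommRing A] (P : Polynomial (Polynomial A)) (k l : ℕ) :
    ((Polynomial.Bivariate.swap P).coeff k).coeff l = (P.coeff l).coeff k := by
  induction P using Polynomial.induction_on' with
  | add p q hp hq => simp [hp, hq]
  | monomial i f =>
    induction f using Polynomial.induction_on' with
    | add p q hp hq => simp only [map_add, Polynomial.coeff_add, hp, hq]
    | monomial j a =>
      rw [Polynomial.Bivariate.swap_monomial_monomial]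
      simp only [Polynomial.coeff_monomial]
      split_ifs <;> simp_all [Polynomial.coeff_monomial]

/-- The substitution p_r ↦ p_r - z₁^r - z₂^r is symmetric in z₁ and z₂. -/
theorem removeTwoVars_coeff_comm (F : MvPolynomial ℕ K) (k l : ℕ) :
    ((removeTwoVars F).coeff k).coeff l = ((removeTwoVars F).coeff l).coeff k := by
  have h : (Polynomial.Bivariate.swap (R := MvPolynomial ℕ K)) (removeTwoVars F) =
      removeTwoVars F := by
    have : ((Polynomial.Bivariate.swap (R := MvPolynomial ℕ K)).toAlgHom.restrictScalars K).comp
        removeTwoVars = removeTwoVars := by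
      ext r : 1
      simp only [removeTwoVars, removeVar, AlgHom.comp_apply, MvPolynomial.aeval_X, map_sub,
        map_pow, Polynomial.coe_mapAlgHom, Polynomial.map_C, Polynomial.map_X, RingHom.coe_coe,
        AlgHom.restrictScalars_apply, AlgEquiv.toAlgHom_apply,
        Polynomial.Bivariate.swap_C_C, Polynomial.Bivariate.swap_X, Polynomial.Bivariate.swap_Y]
      ring
    exact DFunLike.congr_fun this F
  conv_lhs => rw [← h]
  exact coeff_coeff_swap _ _ _

theorem jing_jing [CharZero K] (t : K) (a b : ℕ) (F : MvPolynomial ℕ K) {N : ℕ}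
    (hN : (removeVar F).natDegree < N)
    (hN' : ∀ l, (removeVar ((removeVar F).coeff l)).natDegree < N) :
    jing t a (jing t b F) = ∑ l ∈ Finset.range N, ∑ k ∈ Finset.range N,
      ((removeTwoVars F).coeff l).coeff k * quadQ t (a + k) (b + l) := by
  rw [jing_apply, jing_apply, pairQ_eq_sum_range _ _ _ hN, map_sum, map_sum]
  refine Finset.sum_congr rfl fun l _ => ?_
  rw [map_mul, removeVar_qFun, Finset.mul_sum, map_sum]
  simp_rw [coeff_coeff_removeTwoVars, quadQ, Finset.mul_sum]
  rw [Finset.sum_comm]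
  refine Finset.sum_congr rfl fun j _ => ?_
  rw [mul_left_comm, ← Polynomial.smul_eq_C_mul, map_smul, pairQ_mul_X_pow,
    pairQ_eq_sum_range _ _ _ (hN' l), smul_eq_mul, Finset.mul_sum]
  refine Finset.sum_congr rfl fun k _ => ?_
  rw [add_right_comm a j k]
  ring

/-- By `jing_jing` and `quadQ_succ_sub`, the difference of the two sides pairs coefficients
symmetric in (k, l) with an expression antisymmetric in (k, l), so it vanishes. -/
theorem jing_comm [CharZero K] (t : K) (m : ℕ) :
    jing t m * jing t (m + 1) = t • (jing t (m + 1) * jing t m) := by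
  refine LinearMap.ext fun F => ?_
  obtain ⟨N, hN, hN'⟩ : ∃ N, (removeVar F).natDegree < N ∧
      ∀ l, (removeVar ((removeVar F).coeff l)).natDegree < N := by
    -- A single truncation bound for both variables makes the double sum square, so that its indices
    -- can be interchanged.
    refine ⟨(removeVar F).natDegree + 1 + (Finset.range ((removeVar F).natDegree + 1)).sup
      fun l => (removeVar ((removeVar F).coeff l)).natDegree, by omega, fun l => ?_⟩
    by_cases hl : l < (removeVar F).natDegree + 1
    · have := Finset.le_sup (f := fun l => (removeVar ((removeVar F).coeff l)).natDegree)
        (Finset.mem_range.2 hl)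
      omega
    · rw [Polynomial.coeff_eq_zero_of_natDegree_lt (by omega)]
      simp
  rw [Module.End.mul_apply, LinearMap.smul_apply, Module.End.mul_apply, jing_jing t _ _ F hN hN',
    jing_jing t _ _ F hN hN', MvPolynomial.smul_eq_C_mul, ← sub_eq_zero, Finset.mul_sum,
    ← Finset.sum_sub_distrib]
  have h : ∀ l k, ((removeTwoVars F).coeff l).coeff k * quadQ t (m + k) (m + 1 + l) -
      MvPolynomial.C t * (((removeTwoVars F).coeff l).coeff k * quadQ t (m + 1 + k) (m + l)) =
      ((removeTwoVars F).coeff l).coeff k * (qFun t (m + k) * qFun t (m + l + 1)) -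
      ((removeTwoVars F).coeff l).coeff k * (qFun t (m + l) * qFun t (m + k + 1)) := by
    intro l k
    have := quadQ_succ_sub t (m + k) (m + l)
    rw [add_right_comm m 1 l, add_right_comm m 1 k]
    linear_combination ((removeTwoVars F).coeff l).coeff k * this
  simp_rw [Finset.mul_sum, ← Finset.sum_sub_distrib, h, Finset.sum_sub_distrib]
  rw [sub_eq_zero, Finset.sum_comm]
  simp_rw [removeTwoVars_coeff_comm F]

end Operators

/-! ### Gaussian binomials and the noncommutative q-binomial theorem. -/

section Gauss

variable {K : Type*} [Field K]

theorem qPoch_zero (a q : K) : qPoch a q 0 = 1 := by simp [qPoch]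

theorem qPoch_succ (t : K) (k : ℕ) : qPoch t t (k + 1) = qPoch t t k * (1 - t ^ (k + 1)) := by
  rw [qPoch, Finset.prod_range_succ, ← qPoch, pow_succ']

theorem qPoch_ne_zero {t : K} (ht : ∀ r : ℕ, t ^ (r + 1) ≠ 1) (k : ℕ) : qPoch t t k ≠ 0 := by
  induction k with
  | zero => simp [qPoch_zero]
  | succ k ih =>
    rw [qPoch_succ]
    exact mul_ne_zero ih (sub_ne_zero.2 (ht k).symm)

/-- The Gaussian binomial coefficient, for `j ≤ a`. -/
def gaussBinom (t : K) (a j : ℕ) : K := qPoch t t a / (qPoch t t j * qPoch t t (a - j))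

theorem gaussBinom_zero {t : K} (ht : ∀ r : ℕ, t ^ (r + 1) ≠ 1) (a : ℕ) :
    gaussBinom t a 0 = 1 := by
  simp [gaussBinom, qPoch_zero, div_self (qPoch_ne_zero ht a)]

theorem gaussBinom_self {t : K} (ht : ∀ r : ℕ, t ^ (r + 1) ≠ 1) (a : ℕ) :
    gaussBinom t a a = 1 := by
  simp [gaussBinom, qPoch_zero, div_self (qPoch_ne_zero ht a)]

theorem gaussBinom_succ {t : K} (ht : ∀ r : ℕ, t ^ (r + 1) ≠ 1) {a j : ℕ} (h : j < a) :
    gaussBinom t (a + 1) (j + 1) = gaussBinom t a (j + 1) + t ^ (a - j) * gaussBinom t a j := by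
  obtain ⟨d, rfl⟩ := Nat.exists_eq_add_of_lt h
  simp only [gaussBinom, show j + d + 1 + 1 - (j + 1) = d + 1 by omega,
    show j + d + 1 - (j + 1) = d by omega, show j + d + 1 - j = d + 1 by omega]
  rw [qPoch_succ t (j + d + 1), qPoch_succ t j, qPoch_succ t d]
  have h1 := qPoch_ne_zero ht j
  have h2 := qPoch_ne_zero ht d
  have h3 : (1 : K) - t ^ (j + 1) ≠ 0 := sub_ne_zero.2 (ht j).symm
  have h4 : (1 : K) - t ^ (d + 1) ≠ 0 := sub_ne_zero.2 (ht d).symm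
  field_simp
  ring

/-- The coefficient `y^j t^(j choose 2) [a choose j]`. -/
def branchCoeff (t y : K) (a j : ℕ) : K := y ^ j * t ^ j.choose 2 * gaussBinom t a j

theorem branchCoeff_zero {t : K} (ht : ∀ r : ℕ, t ^ (r + 1) ≠ 1) (y : K) (a : ℕ) :
    branchCoeff t y a 0 = 1 := by
  simp [branchCoeff, gaussBinom_zero ht]

/-- The boundary case of the Pascal recurrence needs its own statement: subtraction truncates, so
`gaussBinom t a (a + 1)` need not vanish. -/
theorem branchCoeff_succ_self {t : K} (ht : ∀ r : ℕ, t ^ (r + 1) ≠ 1) (y : K) (a : ℕ) :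
    branchCoeff t y (a + 1) (a + 1) = y * t ^ a * branchCoeff t y a a := by
  simp only [branchCoeff, gaussBinom_self ht, Nat.choose_succ_succ' a 1, Nat.choose_one_right]
  ring

theorem branchCoeff_succ {t : K} (ht : ∀ r : ℕ, t ^ (r + 1) ≠ 1) (y : K) {a j : ℕ} (h : j < a) :
    branchCoeff t y (a + 1) (j + 1) =
      branchCoeff t y a (j + 1) + y * t ^ a * branchCoeff t y a j := by
  simp only [branchCoeff, gaussBinom_succ ht h, Nat.choose_succ_succ' j 1, Nat.choose_one_right]
  obtain ⟨d, rfl⟩ := Nat.exists_eq_add_of_lt h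
  rw [show j + d + 1 - j = d + 1 by omega]
  ring

variable {A : Type*} [Ring A] [Algebra K A]

theorem mul_pow_of_q_comm {t : K} {B D : A} (h : D * B = t • (B * D)) (a : ℕ) :
    D * B ^ a = t ^ a • (B ^ a * D) := by
  induction a with
  | zero => simp
  | succ a ih =>
    rw [pow_succ, ← mul_assoc, ih, smul_mul_assoc, mul_assoc, h, mul_smul_comm, smul_smul,
      ← pow_succ, mul_assoc]

/-- A noncommutative `q`-binomial theorem. -/
theorem mul_pow_eq_sum_branchCoeff {t : K} (ht : ∀ r : ℕ, t ^ (r + 1) ≠ 1) {y : K} {B D T : A}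
    (hT : T * B = B * T + y • (T * D)) (hD : D * B = t • (B * D)) (a : ℕ) :
    T * B ^ a = ∑ j ∈ Finset.range (a + 1),
      branchCoeff t y a j • (B ^ (a - j) * T * D ^ j) := by
  induction a with
  | zero => simp [branchCoeff_zero ht]
  | succ a ih =>
    -- Peel off the first B with `hT`; moving the resulting D to the right past B^a costs t^a.
    have e1 : T * B ^ (a + 1) = B * (T * B ^ a) + (y * t ^ a) • ((T * B ^ a) * D) := by
      rw [pow_succ', ← mul_assoc, hT, add_mul, mul_assoc, smul_mul_assoc, mul_assoc,
        mul_pow_of_q_comm hD, mul_smul_comm, smul_smul, ← mul_assoc T]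
    have e2 : B * (T * B ^ a) = B ^ (a + 1) * T +
        ∑ j ∈ Finset.range a, branchCoeff t y a (j + 1) • (B ^ (a - j) * T * D ^ (j + 1)) := by
      rw [ih, Finset.sum_range_succ', branchCoeff_zero ht, mul_add, Finset.mul_sum, add_comm]
      congr 1
      · simp [pow_succ', mul_assoc]
      · refine Finset.sum_congr rfl fun j hj => ?_
        rw [mul_smul_comm, ← mul_assoc, ← mul_assoc, ← pow_succ',
          show a - (j + 1) + 1 = a - j by have := Finset.mem_range.1 hj; omega]
    have e3 : (T * B ^ a) * D = ∑ j ∈ Finset.range (a + 1),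
        branchCoeff t y a j • (B ^ (a - j) * T * D ^ (j + 1)) := by
      rw [ih, Finset.sum_mul]
      refine Finset.sum_congr rfl fun j _ => ?_
      rw [smul_mul_assoc, mul_assoc _ _ D, ← pow_succ]
    have e4 : ∑ j ∈ Finset.range a,
        branchCoeff t y (a + 1) (j + 1) • (B ^ (a - j) * T * D ^ (j + 1)) =
        ∑ j ∈ Finset.range a, branchCoeff t y a (j + 1) • (B ^ (a - j) * T * D ^ (j + 1)) +
        (y * t ^ a) • ∑ j ∈ Finset.range a,
          branchCoeff t y a j • (B ^ (a - j) * T * D ^ (j + 1)) := by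
      rw [Finset.smul_sum, ← Finset.sum_add_distrib]
      refine Finset.sum_congr rfl fun j hj => ?_
      rw [branchCoeff_succ ht y (Finset.mem_range.1 hj), add_smul, mul_smul]
    rw [e1, e2, e3, Finset.sum_range_succ' _ (a + 1), Finset.sum_range_succ _ a]
    simp only [Nat.add_sub_add_right, Nat.sub_zero, pow_zero, mul_one]
    rw [Finset.sum_range_succ _ a, e4, branchCoeff_zero ht, branchCoeff_succ_self ht, one_smul,
      smul_add, mul_smul (y * t ^ a)]
    abel

end Gauss

/-! ### Branching of Hall–Littlewood functions on adding a geometric progression. -/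

section Branching

variable {K : Type*} [Field K]

/-- The Hall-Littlewood function, up to a scalar, of the partition whose `i`-th column
has length `c (i - 1) - e` for `1 ≤ i ≤ m`. -/
noncomputable def columnQ (t : K) : ℕ → (ℕ → ℕ) → ℕ → MvPolynomial ℕ K
  | 0, _, _ => 1
  | m + 1, c, e => (jing t (m + 1) ^ (c m - e)) (columnQ t m c (c m))

theorem columnQ_congr (t : K) {m : ℕ} {c c' : ℕ → ℕ} (h : ∀ i < m, c i = c' i) (e : ℕ) :
    columnQ t m c e = columnQ t m c' e := by
  induction m generalizing e with
  | zero => rfl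
  | succ m ih =>
    rw [columnQ, columnQ, h m (Nat.lt_succ_self m), ih fun i hi => h i (hi.trans (Nat.lt_succ_self m))]

/-- Applying B_m again only increases the number of rows of length m, which lowers the offset to b.
For m = 0 nothing changes, since B_0 fixes 1. -/
theorem jing_pow_columnQ (t : K) (m : ℕ) {c : ℕ → ℕ} (hc : Antitone c) {b : ℕ} (hb : b ≤ c m) :
    (jing t m ^ (c m - b)) (columnQ t m c (c m)) = columnQ t m c b := by
  cases m with
  | zero =>
    rw [columnQ, columnQ]
    generalize c 0 - b = k
    induction k with
    | zero => simp
    | succ k ih => rw [pow_succ, Module.End.mul_apply, jing_one, ih]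
  | succ m =>
    rw [columnQ, columnQ, ← Module.End.mul_apply, ← pow_add]
    congr 2
    have := hc (Nat.le_succ m)
    simp only [Nat.succ_eq_add_one] at this
    omega

/-- The sequences `μ` (columns of a partition) contained in `c` with at most `m` entries above
the final value `e`. -/
noncomputable def subColumns (c : ℕ → ℕ) : ℕ → ℕ → Finset (ℕ → ℕ)
  | 0, e => {fun _ => e}
  | m + 1, e => open Classical in (Finset.Icc e (c m)).biUnion fun b =>
      (subColumns c m b).image fun μ i => if i ≤ m then μ i else e

theorem mem_subColumns {c : ℕ → ℕ} {m e : ℕ} {μ : ℕ → ℕ} :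
    μ ∈ subColumns c m e ↔
      (∀ i, μ (i + 1) ≤ μ i) ∧ (∀ i < m, μ i ≤ c i) ∧ ∀ i, m ≤ i → μ i = e := by
  induction m generalizing e μ with
  | zero =>
    rw [subColumns, Finset.mem_singleton]
    constructor
    · rintro rfl
      simp
    · rintro ⟨-, -, h⟩
      exact funext fun i => h i (Nat.zero_le i)
  | succ m ih =>
    classical
    simp only [subColumns, Finset.mem_biUnion, Finset.mem_image, Finset.mem_Icc]
    constructor
    · rintro ⟨b, ⟨h1, h2⟩, ν, hν, rfl⟩
      obtain ⟨h3, h4, h5⟩ := ih.1 hν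
      have h6 := h5 m le_rfl
      refine ⟨fun i => ?_, fun i hi => ?_, fun i hi => ?_⟩ <;> dsimp only
      · have h7 := h3 i
        rcases lt_trichotomy i m with h | rfl | h
        · rw [if_pos (by omega), if_pos (by omega)]
          exact h7
        · rw [if_neg (by omega), if_pos le_rfl]
          omega
        · rw [if_neg (by omega), if_neg (by omega)]
      · rw [if_pos (by omega)]
        rcases Nat.lt_succ_iff_lt_or_eq.1 hi with h | rfl
        · exact h4 i h
        · omega
      · rw [if_neg (by omega)]
    · rintro ⟨h1, h2, h3⟩
      have hanti : Antitone μ := antitone_nat_of_succ_le h1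
      refine ⟨μ m, ⟨?_, h2 m (Nat.lt_succ_self m)⟩, fun i => if i ≤ m then μ i else μ m,
        ih.2 ⟨fun i => ?_, fun i hi => ?_, fun i hi => ?_⟩, ?_⟩ <;> try dsimp only
      · rw [← h3 (m + 1) le_rfl]
        exact h1 m
      · have h7 := h1 i
        rcases lt_trichotomy i m with h | rfl | h
        · rw [if_pos (by omega), if_pos (by omega)]
          exact h7
        · rw [if_neg (by omega), if_pos le_rfl]
        · rw [if_neg (by omega), if_neg (by omega)]
      · rw [if_pos hi.le]
        exact h2 i (hi.trans (Nat.lt_succ_self m))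
      · rcases hi.eq_or_lt with rfl | h
        · simp
        · rw [if_neg (by omega)]
      · funext i
        by_cases h : i ≤ m
        · simp [h]
        · rw [if_neg h, h3 i (by omega)]

theorem sum_subColumns_succ {M : Type*} [AddCommMonoid M] (c : ℕ → ℕ) (m e : ℕ)
    (f : (ℕ → ℕ) → M) :
    ∑ μ ∈ subColumns c (m + 1) e, f μ = ∑ b ∈ Finset.Icc e (c m), ∑ μ ∈ subColumns c m b,
      f fun i => if i ≤ m then μ i else e := by
  classical
  rw [subColumns, Finset.sum_biUnion]
  · refine Finset.sum_congr rfl fun b _ => Finset.sum_image fun μ hμ ν hν h => ?_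
    have h1 := (mem_subColumns.1 hμ).2.2
    have h2 := (mem_subColumns.1 hν).2.2
    funext i
    by_cases hi : i ≤ m
    · simpa [hi] using congrFun h i
    · rw [h1 i (by omega), h2 i (by omega)]
  · intro b _ b' _ hbb'
    refine Finset.disjoint_left.2 fun μ hμ hμ' => hbb' ?_
    obtain ⟨ν, hν, rfl⟩ := Finset.mem_image.1 hμ
    obtain ⟨ν', hν', h⟩ := Finset.mem_image.1 hμ'
    have h1 := congrFun h m
    simp only [le_refl, if_true] at h1
    rw [← (mem_subColumns.1 hν).2.2 m le_rfl, ← (mem_subColumns.1 hν').2.2 m le_rfl, h1]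

/-- The branching weight of removing the strip between the columns `c` and `μ`. -/
def stripWeight (t y : K) (m : ℕ) (c μ : ℕ → ℕ) : K :=
  ∏ i ∈ Finset.range m, branchCoeff t y (c i - μ (i + 1)) (c i - μ i)

/-- The q-binomial theorem moves T_y past B_{m+1}^{c m - e}. Each of the j operators B_{m+1} turned
into B_m shortens a row from m + 1 to m, so column m + 1 drops to length b = c m - j. These B_m
merge with the inner function, whose offset becomes b, and the induction applies to it. -/
theorem addVar_columnQ [CharZero K] {t : K} (ht : ∀ r : ℕ, t ^ (r + 1) ≠ 1) (y : K) (m : ℕ)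
    {c : ℕ → ℕ} (hc : Antitone c) {e : ℕ} (he : ∀ i < m, e ≤ c i) :
    addVar t y (columnQ t m c e) =
      ∑ μ ∈ subColumns c m e, stripWeight t y m c μ • columnQ t m μ e := by
  induction m generalizing e with
  | zero => simp [subColumns, columnQ, stripWeight]
  | succ m ih =>
    have hT : (addVar t y).toLinearMap * jing t (m + 1) =
        jing t (m + 1) * (addVar t y).toLinearMap + y • ((addVar t y).toLinearMap * jing t m) := by
      refine LinearMap.ext fun F => ?_
      simp only [LinearMap.add_apply, LinearMap.smul_apply, Module.End.mul_apply,
        AlgHom.toLinearMap_apply, MvPolynomial.smul_eq_C_mul]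
      exact addVar_jing_succ ht y m F
    have key := mul_pow_eq_sum_branchCoeff ht hT (jing_comm t m) (c m - e)
    have key2 := LinearMap.congr_fun key (columnQ t m c (c m))
    rw [columnQ, sum_subColumns_succ]
    rw [Module.End.mul_apply, AlgHom.toLinearMap_apply] at key2
    rw [key2, LinearMap.sum_apply]
    have hem := he m (Nat.lt_succ_self m)
    refine Finset.sum_bij' (fun j _ => c m - j) (fun b _ => c m - b)
      (fun j hj => ?_) (fun b hb => ?_) (fun j hj => ?_) (fun b hb => ?_) (fun j hj => ?_)
    · rw [Finset.mem_range] at hj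
      rw [Finset.mem_Icc]
      omega
    · rw [Finset.mem_Icc] at hb
      rw [Finset.mem_range]
      omega
    · rw [Finset.mem_range] at hj
      omega
    · rw [Finset.mem_Icc] at hb
      omega
    · rw [Finset.mem_range] at hj
      obtain ⟨b, hb⟩ : ∃ b, b = c m - j := ⟨_, rfl⟩
      have hj' : j = c m - b := by omega
      rw [← hb, hj', LinearMap.smul_apply, Module.End.mul_apply, Module.End.mul_apply,
        jing_pow_columnQ t m hc (by omega), AlgHom.toLinearMap_apply,
        ih (e := b) fun i hi => (hc hi.le).trans' (by omega), map_sum, Finset.smul_sum]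
      refine Finset.sum_congr rfl fun μ hμ => ?_
      have hμm := (mem_subColumns.1 hμ).2.2 m le_rfl
      rw [map_smul, smul_smul, stripWeight, stripWeight, Finset.prod_range_succ, columnQ]
      simp only [le_refl, if_true, if_neg (Nat.not_succ_le_self m), hμm]
      rw [mul_comm (branchCoeff _ _ _ _), show c m - e - (c m - b) = b - e by omega]
      congr 1
      · congr 1
        refine Finset.prod_congr rfl fun i hi => ?_
        rw [Finset.mem_range] at hi
        rw [if_pos (by omega), if_pos (by omega)]
      · congr 1
        refine columnQ_congr t (fun i hi => ?_) _
        rw [if_pos hi.le]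

end Branching

/-! ### Flags of column sequences and the index arrays. -/

/-- Prepend a row to an array. -/
def consArray (c : ℕ → ℕ) (s : ℕ → ℕ → ℕ) : ℕ → ℕ → ℕ
  | 0 => c
  | j + 1 => s j

/-- The flags of column sequences of length `n` starting at `c` and ending at zero. -/
noncomputable def columnArrays (m : ℕ) : ℕ → (ℕ → ℕ) → Finset (ℕ → ℕ → ℕ)
  | 0, c => open Classical in if ∀ i, c i = 0 then {fun _ _ => 0} else ∅
  | n + 1, c => open Classical in (subColumns c m 0).biUnion fun μ =>
      (columnArrays m n μ).image (consArray c)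

/-- Matches the recursive flags produced by repeated branching with the inequalities that define the
index set. -/
theorem mem_columnArrays {m n : ℕ} {c : ℕ → ℕ} (hc : Antitone c) (hcm : ∀ i, m ≤ i → c i = 0)
    {s : ℕ → ℕ → ℕ} :
    s ∈ columnArrays m n c ↔ (∀ i, s 0 i = c i) ∧ (∀ i, s n i = 0) ∧ (∀ j, s j m = 0) ∧
      (∀ j i, s j (i + 1) ≤ s j i) ∧ (∀ j i, s (j + 1) i ≤ s j i) := by
  classical
  induction n generalizing c s with
  | zero =>
    rw [columnArrays]
    constructor
    · intro h
      split_ifs at h with h0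
      · rw [Finset.mem_singleton] at h
        subst h
        simp [h0]
      · simp at h
    · rintro ⟨h1, h2, h3, h4, h5⟩
      rw [if_pos fun i => by rw [← h1, h2], Finset.mem_singleton]
      funext j i
      induction j with
      | zero => exact h2 i
      | succ j ih =>
        have := h5 j i
        omega
  | succ n ih =>
    simp only [columnArrays, Finset.mem_biUnion, Finset.mem_image]
    constructor
    · rintro ⟨μ, hμ, s, hs, rfl⟩
      obtain ⟨h1, h2, h3⟩ := mem_subColumns.1 hμ
      obtain ⟨g1, g2, g3, g4, g5⟩ := (ih (antitone_nat_of_succ_le h1) h3).1 hs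
      refine ⟨fun i => rfl, g2, fun j => ?_, fun j i => ?_, fun j i => ?_⟩
      · cases j with
        | zero => exact hcm m le_rfl
        | succ j => exact g3 j
      · cases j with
        | zero => exact hc (Nat.le_succ i)
        | succ j => exact g4 j i
      · cases j with
        | zero =>
          change s 0 i ≤ c i
          rw [g1]
          by_cases hi : i < m
          · exact h2 i hi
          · rw [h3 i (by omega)]
            exact Nat.zero_le _
        | succ j => exact g5 j i
    · rintro ⟨h1, h2, h3, h4, h5⟩
      have h6 : ∀ i, m ≤ i → s 1 i = 0 := fun i hi =>
        Nat.eq_zero_of_le_zero ((h3 1).symm ▸ antitone_nat_of_succ_le (h4 1) hi)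
      refine ⟨s 1, mem_subColumns.2 ⟨h4 1, fun i _ => h1 i ▸ h5 0 i, h6⟩,
        fun j => s (j + 1), ?_, ?_⟩
      · exact (ih (antitone_nat_of_succ_le (h4 1)) h6).2 ⟨fun i => rfl, h2, fun j => h3 _,
          fun j => h4 _, fun j => h5 _⟩
      · funext j
        cases j with
        | zero => exact (funext h1).symm
        | succ j => rfl

theorem sum_columnArrays_succ {M : Type*} [AddCommMonoid M] (m n : ℕ) {c : ℕ → ℕ}
    (f : (ℕ → ℕ → ℕ) → M) :
    ∑ s ∈ columnArrays m (n + 1) c, f s =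
      ∑ μ ∈ subColumns c m 0, ∑ s ∈ columnArrays m n μ, f (consArray c s) := by
  classical
  have inj : Function.Injective (consArray c) := fun s s' h =>
    funext fun j => congrFun h (j + 1)
  rw [columnArrays, Finset.sum_biUnion]
  · exact Finset.sum_congr rfl fun μ _ => Finset.sum_image fun s _ s' _ h => inj h
  · intro μ hμ ν hν hne
    refine Finset.disjoint_left.2 fun s hs hs' => hne ?_
    obtain ⟨s, h1, rfl⟩ := Finset.mem_image.1 hs
    obtain ⟨s', h2, h⟩ := Finset.mem_image.1 hs'
    obtain rfl := inj h
    have hμ' := mem_subColumns.1 hμ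
    have hν' := mem_subColumns.1 hν
    have h3 := ((mem_columnArrays (antitone_nat_of_succ_le hμ'.1) hμ'.2.2).1 h1).1
    have h4 := ((mem_columnArrays (antitone_nat_of_succ_le hν'.1) hν'.2.2).1 h2).1
    exact funext fun i => (h3 i).symm.trans (h4 i)

theorem arrays_eq_columnArrays {lam : YoungDiagram} {m : ℕ} (hlam : lam.rowLen 0 ≤ m) (n : ℕ) :
    arrays lam m n = columnArrays m n lam.colLen := by
  have h : ∀ i, m ≤ i → lam.colLen i = 0 := by
    intro i hi
    by_contra h0
    have h1 : ((0, i) : ℕ × ℕ) ∈ lam := YoungDiagram.mem_iff_lt_colLen.2 (Nat.pos_of_ne_zero h0)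
    have h2 := YoungDiagram.mem_iff_lt_rowLen.1 h1
    omega
  ext s
  rw [mem_columnArrays (fun i j hij => lam.colLen_anti i j hij) h, arrays,
    Set.Finite.mem_toFinset]
  rfl

/-! ### Evaluation on a union of geometric progressions. -/

section Evaluation

variable {K : Type*} [Field K]

theorem aeval_zero_qFun (t : K) (r : ℕ) :
    MvPolynomial.aeval (fun _ : ℕ => (0 : K)) (qFun t (r + 1)) = 0 := by
  rw [qFun]
  simp

/-- B_{m+1} F is a combination of q_r with r > 0, all of which vanish on the empty alphabet. Hence
only the empty partition survives at the end of a flag. -/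
theorem aeval_zero_jing (t : K) (m : ℕ) (F : MvPolynomial ℕ K) :
    MvPolynomial.aeval (fun _ : ℕ => (0 : K)) (jing t (m + 1) F) = 0 := by
  rw [jing_apply, pairQ_eq_sum_range _ _ _ (Nat.lt_succ_self _), map_sum]
  refine Finset.sum_eq_zero fun k _ => ?_
  rw [map_mul, add_right_comm, aeval_zero_qFun, mul_zero]

theorem aeval_zero_columnQ (t : K) {m : ℕ} {c : ℕ → ℕ} {e : ℕ} (h : ∃ i < m, e < c i) :
    MvPolynomial.aeval (fun _ : ℕ => (0 : K)) (columnQ t m c e) = 0 := by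
  induction m generalizing e with
  | zero =>
    obtain ⟨i, hi, -⟩ := h
    omega
  | succ m ih =>
    rw [columnQ]
    obtain ⟨i, hi, hei⟩ := h
    rcases Nat.eq_zero_or_pos (c m - e) with h0 | h0
    · rw [h0, pow_zero, Module.End.one_apply]
      rcases Nat.lt_succ_iff_lt_or_eq.1 hi with h1 | rfl
      · exact ih ⟨i, h1, by omega⟩
      · omega
    · obtain ⟨k, hk⟩ := Nat.exists_eq_succ_of_ne_zero h0.ne'
      rw [hk, Nat.succ_eq_add_one, pow_succ', Module.End.mul_apply, aeval_zero_jing]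

theorem columnQ_of_forall_eq (t : K) {m : ℕ} {c : ℕ → ℕ} {e : ℕ} (h : ∀ i < m, c i = e) :
    columnQ t m c e = 1 := by
  induction m with
  | zero => rfl
  | succ m ih =>
    rw [columnQ, h m (Nat.lt_succ_self m), Nat.sub_self, pow_zero, Module.End.one_apply,
      ih fun i hi => h i (hi.trans (Nat.lt_succ_self m))]

theorem aeval_columnQ [CharZero K] {t : K} (ht : ∀ r : ℕ, t ^ (r + 1) ≠ 1) (m n : ℕ) (y : ℕ → K)
    {c : ℕ → ℕ} (hc : Antitone c) (hcm : ∀ i, m ≤ i → c i = 0) :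
    MvPolynomial.aeval (fun r : ℕ => ∑ a ∈ Finset.range n, y a ^ (r + 1) / (1 - t ^ (r + 1)))
        (columnQ t m c 0) =
      ∑ s ∈ columnArrays m n c,
        ∏ a ∈ Finset.range n, stripWeight t (y a) m (s a) (s (a + 1)) := by
  induction n generalizing c y with
  | zero =>
    simp only [Finset.range_zero, Finset.sum_empty, Finset.prod_empty]
    rw [columnArrays]
    split_ifs with h
    · rw [columnQ_of_forall_eq t fun i _ => h i]
      simp
    · push Not at h
      obtain ⟨i, hi⟩ := h
      rw [aeval_zero_columnQ t ⟨i, not_le.1 fun h => hi (hcm i h), Nat.pos_of_ne_zero hi⟩]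
      simp
  | succ n ih =>
    -- The progression starting at y_0 is split off as one `addVar`; the others are shifted down by
    -- one index.
    have hcomp : MvPolynomial.aeval
        (fun r : ℕ => ∑ a ∈ Finset.range (n + 1), y a ^ (r + 1) / (1 - t ^ (r + 1))) =
        (MvPolynomial.aeval fun r : ℕ => ∑ a ∈ Finset.range n,
          y (a + 1) ^ (r + 1) / (1 - t ^ (r + 1))).comp (addVar t (y 0)) := by
      ext r
      simp [addVar, Finset.sum_range_succ']
    rw [hcomp, AlgHom.comp_apply, addVar_columnQ ht _ m hc fun i _ => Nat.zero_le _, map_sum,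
      sum_columnArrays_succ]
    refine Finset.sum_congr rfl fun μ hμ => ?_
    have hμ' := mem_subColumns.1 hμ
    have hanti := antitone_nat_of_succ_le hμ'.1
    rw [map_smul, ih (fun a => y (a + 1)) hanti hμ'.2.2, Finset.smul_sum]
    refine Finset.sum_congr rfl fun s hs => ?_
    rw [Finset.prod_range_succ', smul_eq_mul, mul_comm]
    have h0 : s 0 = μ := funext ((mem_columnArrays hanti hμ'.2.2).1 hs).1
    simp only [consArray, h0]

/-- With y = q^a, t = q^n and d = s_i^{(a)} - s_i^{(a+1)}, a strip contributes q^(a d + n (d choose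
2)). Summed over i and a, these exponents give A(s) by telescoping, and the Gaussian binomials give
the first product in B(s). -/
theorem coeffB_mul_pow {q : K} {m n : ℕ} {lam : YoungDiagram}
    {s : ℕ → ℕ → ℕ} (hs : s ∈ arrays lam m n) :
    coeffB m n s (q ^ n) * q ^ ⌊expA m n s⌋₊ =
      (∏ i ∈ Finset.range m, 1 / qPoch (q ^ n) (q ^ n) (lam.colLen i - lam.colLen (i + 1))) *
        ∏ a ∈ Finset.range n, stripWeight (q ^ n) (q ^ a) m (s a) (s (a + 1)) := by
  obtain ⟨h0, hn, hm, hi, hj⟩ : s ∈ indexArrays lam m n := by simpa [arrays] using hs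
  have hA : ⌊expA m n s⌋₊ = ∑ i ∈ Finset.range m, ∑ a ∈ Finset.range n,
      (a * (s a i - s (a + 1) i) + n * (s a i - s (a + 1) i).choose 2) := by
    have hcast := natFloor_expA hs
    rcases Nat.eq_zero_or_pos n with rfl | hpos
    · simp [expA]
    have key : ∀ i, ∑ a ∈ Finset.range n, ((a * (s a i - s (a + 1) i) +
        n * (s a i - s (a + 1) i).choose 2 : ℕ) : ℚ) =
        -((n : ℚ) / 2) * s 0 i + ∑ j ∈ Finset.Ico 1 n, (s j i : ℚ) +
          ((n : ℚ) / 2) * ∑ a ∈ Finset.range n, ((s a i : ℚ) - (s (a + 1) i : ℚ)) ^ 2 := by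
      intro i
      have e1 : ∀ a, ((a * (s a i - s (a + 1) i) + n * (s a i - s (a + 1) i).choose 2 : ℕ) : ℚ) =
          (a : ℚ) * ((s a i : ℚ) - s (a + 1) i) - ((n : ℚ) / 2) * ((s a i : ℚ) - s (a + 1) i) +
            ((n : ℚ) / 2) * ((s a i : ℚ) - s (a + 1) i) ^ 2 := by
        intro a
        rw [Nat.cast_add, Nat.cast_mul, Nat.cast_mul, Nat.cast_choose_two, Nat.cast_sub (hj a i)]
        ring
      rw [Finset.sum_congr rfl fun a _ => e1 a, Finset.sum_add_distrib, Finset.sum_sub_distrib,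
        ← Finset.mul_sum, ← Finset.mul_sum, sum_telescope (fun a => (s a i : ℚ)) n hpos,
        Finset.sum_range_sub' (fun a => (s a i : ℚ)), hn i]
      push_cast
      ring
    rw [← Nat.cast_inj (R := ℚ), hcast, Nat.cast_sum,
      Finset.sum_congr rfl fun i _ => (Nat.cast_sum _ _).trans (key i),
      Finset.sum_add_distrib, Finset.sum_add_distrib, ← Finset.mul_sum, ← Finset.mul_sum,
      expA, Finset.sum_comm (s := Finset.Ico 1 n)]
  have hP : ∏ a ∈ Finset.range n, stripWeight (q ^ n) (q ^ a) m (s a) (s (a + 1)) =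
      (∏ i ∈ Finset.range m, ∏ a ∈ Finset.range n,
        qPoch (q ^ n) (q ^ n) (s a i - s (a + 1) (i + 1)) /
        (qPoch (q ^ n) (q ^ n) (s a i - s (a + 1) i) *
          qPoch (q ^ n) (q ^ n) (s (a + 1) i - s (a + 1) (i + 1)))) * q ^ ⌊expA m n s⌋₊ := by
    rw [hA, ← Finset.prod_pow_eq_pow_sum, ← Finset.prod_mul_distrib]
    simp only [stripWeight]
    rw [Finset.prod_comm]
    refine Finset.prod_congr rfl fun i _ => ?_
    rw [← Finset.prod_pow_eq_pow_sum, ← Finset.prod_mul_distrib]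
    refine Finset.prod_congr rfl fun a _ => ?_
    have h1 := hj a i
    have h2 := hi (a + 1) i
    rw [branchCoeff, gaussBinom, show s a i - s (a + 1) (i + 1) - (s a i - s (a + 1) i) =
      s (a + 1) i - s (a + 1) (i + 1) by omega, ← pow_mul, ← pow_mul, ← pow_add, mul_comm]
  rw [hP, coeffB]
  simp only [h0]
  ring

/-- The principal specialization in the parametrization by columns. -/
theorem aeval_principal_columnQ [CharZero K] {q : K} {n : ℕ} (hn : 0 < n) (hq : ∀ r : ℕ, q ^ (r + 1) ≠ 1)
    {lam : YoungDiagram} {m : ℕ} (hlam : lam.rowLen 0 ≤ m) :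
    (∏ i ∈ Finset.range m, 1 / qPoch (q ^ n) (q ^ n) (lam.colLen i - lam.colLen (i + 1))) *
      MvPolynomial.aeval (fun r : ℕ => (1 - q ^ (r + 1))⁻¹)
        (columnQ (q ^ n) m lam.colLen 0) =
      ∑ s ∈ arrays lam m n, coeffB m n s (q ^ n) * q ^ ⌊expA m n s⌋₊ := by
  have ht : ∀ r : ℕ, (q ^ n) ^ (r + 1) ≠ 1 := by
    intro r
    obtain ⟨k, rfl⟩ := Nat.exists_eq_succ_of_ne_zero hn.ne'
    rw [← pow_mul, show k.succ * (r + 1) = (k * (r + 1) + r) + 1 by rw [Nat.succ_mul]; ring]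
    exact hq _
  have hcm : ∀ i, m ≤ i → lam.colLen i = 0 := by
    intro i hi
    by_contra h0
    have h1 : ((0, i) : ℕ × ℕ) ∈ lam := YoungDiagram.mem_iff_lt_colLen.2 (Nat.pos_of_ne_zero h0)
    have h2 := YoungDiagram.mem_iff_lt_rowLen.1 h1
    omega
  -- Sorting exponents modulo n: 1/(1 - q^r) = ∑_{a<n} q^{ar} / (1 - q^{nr}).
  have hp : (fun r : ℕ => (1 - q ^ (r + 1))⁻¹) = fun r : ℕ =>
      ∑ a ∈ Finset.range n, (q ^ a) ^ (r + 1) / (1 - (q ^ n) ^ (r + 1)) := by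
    funext r
    rw [← Finset.sum_div, eq_div_iff (sub_ne_zero.2 (ht r).symm),
      inv_mul_eq_iff_eq_mul₀ (sub_ne_zero.2 (hq r).symm)]
    have := mul_neg_geom_sum (q ^ (r + 1)) n
    simp only [← pow_mul] at this ⊢
    rw [mul_comm n, ← this]
    simp only [mul_comm]
  rw [hp, aeval_columnQ ht m n (fun a => q ^ a) (fun i j hij => lam.colLen_anti i j hij) hcm,
    ← arrays_eq_columnArrays hlam, Finset.mul_sum]
  exact Finset.sum_congr rfl fun s hs => (coeffB_mul_pow hs).symm

end Evaluation

/-! ### Partial fractions and Jing's operators in finitely many variables. -/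

section PartialFractions

variable {L : Type*} [Field L] {ι : Type*} [Fintype ι] [DecidableEq ι]

/-- The coefficient `∏_{j ≠ i} (x_i - t x_j) / (x_i - x_j)`. -/
def hlCoeff (t : L) (x : ι → L) (i : ι) : L :=
  ∏ j ∈ Finset.univ.erase i, (x i - t * x j) / (x i - x j)

/-- Both sides have degree at most the number of variables and agree at 0 and at every 1/x_i, which
is one point more than the degree. -/
theorem prod_one_sub_eq_partialFractions (t : L) {x : ι → L} (hx : Function.Injective x)
    (hx0 : ∀ i, x i ≠ 0) :
    ∏ j, (1 - Polynomial.C (t * x j) * Polynomial.X) =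
      ∏ j, (1 - Polynomial.C (x j) * Polynomial.X) +
        ∑ i, Polynomial.C ((1 - t) * hlCoeff t x i * x i) * (Polynomial.X *
          ∏ j ∈ Finset.univ.erase i, (1 - Polynomial.C (x j) * Polynomial.X)) := by
  have hdeg : ∀ a : L, (1 - Polynomial.C a * Polynomial.X).natDegree ≤ 1 := fun a => by
    refine (Polynomial.natDegree_sub_le _ _).trans ?_
    simpa using (Polynomial.natDegree_C_mul_le a Polynomial.X).trans Polynomial.natDegree_X_le
  have hprod : ∀ (s : Finset ι) (a : ι → L),
      (∏ j ∈ s, (1 - Polynomial.C (a j) * Polynomial.X)).natDegree ≤ s.card := fun s a => by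
    refine (Polynomial.natDegree_prod_le _ _).trans ?_
    simpa using Finset.sum_le_card_nsmul s _ 1 fun j _ => hdeg (a j)
  let node : Option ι → L := fun o => o.elim 0 fun i => (x i)⁻¹
  have hnode : Function.Injective node := by
    rintro (_ | i) (_ | j) h
    · rfl
    · exact absurd h.symm (inv_ne_zero (hx0 j))
    · exact absurd h (inv_ne_zero (hx0 i))
    · exact congrArg some (hx (inv_injective h))
  rw [← sub_eq_zero]
  refine Polynomial.eq_zero_of_natDegree_lt_card_of_eval_eq_zero _ hnode ?_ ?_
  · rintro (_ | i)
    · simp [node, Polynomial.eval_prod, Polynomial.eval_finsetSum]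
    · have h1 : ∏ j ∈ Finset.univ.erase i, (1 - t * x j * (x i)⁻¹) =
          hlCoeff t x i * ∏ j ∈ Finset.univ.erase i, (1 - x j * (x i)⁻¹) := by
        rw [hlCoeff, ← Finset.prod_mul_distrib]
        refine Finset.prod_congr rfl fun j hj => ?_
        have h2 : x i - x j ≠ 0 := sub_ne_zero.2 fun h => Finset.ne_of_mem_erase hj (hx h).symm
        have h3 := hx0 i
        field_simp
      have h4 : ∀ k ∈ Finset.univ, k ≠ i →
          (1 - t) * hlCoeff t x k * x k *
            ((x i)⁻¹ * ∏ j ∈ Finset.univ.erase k, (1 - x j * (x i)⁻¹)) = 0 := fun k _ hk => by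
        rw [Finset.prod_eq_zero (Finset.mem_erase.2 ⟨hk.symm, Finset.mem_univ i⟩)
          (by rw [mul_inv_cancel₀ (hx0 i), sub_self]), mul_zero, mul_zero]
      simp only [node, Option.elim_some, Polynomial.eval_sub, Polynomial.eval_add,
        Polynomial.eval_prod, Polynomial.eval_finsetSum, Polynomial.eval_mul, Polynomial.eval_C,
        Polynomial.eval_X, Polynomial.eval_one]
      rw [Finset.sum_eq_single i h4 (by simp),
        ← Finset.mul_prod_erase Finset.univ (fun j => 1 - t * x j * (x i)⁻¹) (Finset.mem_univ i),
        ← Finset.mul_prod_erase Finset.univ (fun j => 1 - x j * (x i)⁻¹) (Finset.mem_univ i), h1]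
      have h3 := hx0 i
      field_simp
      ring
  · rw [Fintype.card_option, Nat.lt_succ_iff]
    refine (Polynomial.natDegree_sub_le _ _).trans (max_le (hprod _ _) ?_)
    refine (Polynomial.natDegree_add_le _ _).trans (max_le (hprod _ _) ?_)
    refine Polynomial.natDegree_sum_le_of_forall_le _ _ fun i _ => ?_
    refine (Polynomial.natDegree_C_mul_le _ _).trans (Polynomial.natDegree_mul_le.trans ?_)
    refine (add_le_add Polynomial.natDegree_X_le (hprod _ _)).trans ?_
    rw [Finset.card_erase_of_mem (Finset.mem_univ i), Finset.card_univ]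
    have := Fintype.card_pos_iff.2 ⟨i⟩
    omega

/-- Compare top coefficients in the partial fraction identity. -/
theorem sum_hlCoeff (t : L) {x : ι → L} (hx : Function.Injective x) (hx0 : ∀ i, x i ≠ 0) :
    (1 - t) * ∑ i, hlCoeff t x i = 1 - t ^ Fintype.card ι := by
  have hdeg : ∀ a : L, (1 - Polynomial.C a * Polynomial.X).natDegree ≤ 1 := fun a => by
    refine (Polynomial.natDegree_sub_le _ _).trans ?_
    simpa using (Polynomial.natDegree_C_mul_le a Polynomial.X).trans Polynomial.natDegree_X_le
  have hcoeff : ∀ (s : Finset ι) (a : ι → L),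
      (∏ j ∈ s, (1 - Polynomial.C (a j) * Polynomial.X)).coeff s.card = ∏ j ∈ s, -a j :=
    fun s a => by
    have := Polynomial.coeff_prod_of_natDegree_le s
      (fun j => 1 - Polynomial.C (a j) * Polynomial.X) 1 fun j _ => hdeg (a j)
    rw [mul_one] at this
    rw [this]
    refine Finset.prod_congr rfl fun j _ => ?_
    simp [Polynomial.coeff_one]
  have h := congrArg (fun P => Polynomial.coeff P (Fintype.card ι))
    (prod_one_sub_eq_partialFractions t hx hx0)
  simp only [Polynomial.coeff_add, Polynomial.finsetSum_coeff, Polynomial.coeff_C_mul] at h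
  rw [← Finset.card_univ, hcoeff, hcoeff] at h
  have h2 : ∀ i, (1 - t) * hlCoeff t x i * x i * (Polynomial.X *
      ∏ j ∈ Finset.univ.erase i, (1 - Polynomial.C (x j) * Polynomial.X)).coeff
        (Finset.univ : Finset ι).card = -((1 - t) * hlCoeff t x i * ∏ j, -x j) := fun i => by
    have hc : (Finset.univ : Finset ι).card = (Finset.univ.erase i).card + 1 := by
      rw [Finset.card_erase_add_one (Finset.mem_univ i)]
    rw [hc, Polynomial.coeff_X_mul, hcoeff,
      ← Finset.mul_prod_erase Finset.univ (fun j => -x j) (Finset.mem_univ i)]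
    ring
  rw [Finset.sum_congr rfl fun i _ => h2 i, Finset.sum_neg_distrib, ← Finset.sum_mul,
    ← Finset.mul_sum] at h
  have h3 : ∏ j, -(t * x j) = t ^ Fintype.card ι * ∏ j, -x j := by
    rw [← Finset.card_univ, ← Finset.prod_const, ← Finset.prod_mul_distrib]
    exact Finset.prod_congr rfl fun j _ => by ring
  have h4 : ∏ j, -x j ≠ 0 := Finset.prod_ne_zero_iff.2 fun j _ => neg_ne_zero.2 (hx0 j)
  rw [h3] at h
  refine mul_right_cancel₀ h4 ?_
  linear_combination h

variable {K : Type*} [Field K] [Algebra K L]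

/-- Evaluation of a symmetric function at finitely many elements. -/
noncomputable def evalFin (K : Type*) [Field K] [Algebra K L] (x : ι → L) :
    MvPolynomial ℕ K →ₐ[K] L :=
  MvPolynomial.aeval fun r : ℕ => ∑ i, x i ^ (r + 1)

/-- The generating series is ∏ (1 - t x_i z)/(1 - x_i z); its partial fraction expansion has one
geometric series for each x_i. -/
theorem evalFin_qFun_succ [CharZero K] (t : K) {x : ι → L} (hx : Function.Injective x) (hx0 : ∀ i, x i ≠ 0)
    (r : ℕ) :
    evalFin K x (qFun t (r + 1)) =
      (1 - algebraMap K L t) * ∑ i, hlCoeff (algebraMap K L t) x i * x i ^ (r + 1) := by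
  have : CharZero L := charZero_of_injective_algebraMap (algebraMap K L).injective
  set τ := algebraMap K L t with hτ
  have h1 : (PowerSeries.mk fun r => evalFin K x (qFun t r)) =
      ∏ i, ((1 - PowerSeries.C (τ * x i) * PowerSeries.X) * geomSeries (x i)) := by
    refine mk_aeval_qFun_eq t _ ?_
    convert IsExpOf.prod Finset.univ fun i _ =>
      (isExpOf_one_sub (τ * x i)).mul (isExpOf_geomSeries (x i)) using 1
    ext1 k
    simp only [C_mul_geomSeries, PowerSeries.coeff_mk, map_sum, map_add, map_neg, map_sub,
      map_one, map_pow, ← hτ, Finset.mul_sum]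
    refine Finset.sum_congr rfl fun i _ => ?_
    ring
  have h2 := congrArg (Polynomial.coeToPowerSeries.ringHom (R := L))
    (prod_one_sub_eq_partialFractions τ hx hx0)
  simp only [map_prod, map_sub, map_one, map_mul, map_add, map_sum,
    Polynomial.coeToPowerSeries.ringHom_apply, Polynomial.coe_C, Polynomial.coe_X] at h2
  have h3 : ∏ i, ((1 - PowerSeries.C (τ * x i) * PowerSeries.X) * geomSeries (x i)) =
      1 + ∑ i, PowerSeries.C ((1 - τ) * hlCoeff τ x i * x i) *
        (PowerSeries.X * geomSeries (x i)) := by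
    rw [Finset.prod_mul_distrib]
    simp only [map_mul, map_sub, map_one] at h2 ⊢
    rw [h2, add_mul, ← Finset.prod_mul_distrib,
      Finset.prod_congr rfl fun i _ => one_sub_mul_geomSeries (x i), Finset.prod_const_one,
      Finset.sum_mul]
    congr 1
    refine Finset.sum_congr rfl fun i _ => ?_
    rw [← Finset.mul_prod_erase Finset.univ (fun j => geomSeries (x j)) (Finset.mem_univ i)]
    have h4 : (∏ j ∈ Finset.univ.erase i, (1 - PowerSeries.C (x j) * PowerSeries.X)) *
        ∏ j ∈ Finset.univ.erase i, geomSeries (x j) = 1 := by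
      rw [← Finset.prod_mul_distrib,
        Finset.prod_congr rfl fun i _ => one_sub_mul_geomSeries (x i), Finset.prod_const_one]
    linear_combination (1 - PowerSeries.C τ) * PowerSeries.C (hlCoeff τ x i) *
      PowerSeries.C (x i) * PowerSeries.X * geomSeries (x i) * h4
  have h5 := congrArg (PowerSeries.coeff (r + 1)) (h1.trans h3)
  rw [PowerSeries.coeff_mk, map_add, map_sum] at h5
  rw [h5, PowerSeries.coeff_one, if_neg (Nat.succ_ne_zero r), zero_add, Finset.mul_sum]
  refine Finset.sum_congr rfl fun i _ => ?_
  rw [PowerSeries.coeff_C_mul, PowerSeries.coeff_succ_X_mul, geomSeries, PowerSeries.coeff_mk]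
  ring

theorem eval₂_removeVar (p : ℕ → L) (z : L) (F : MvPolynomial ℕ K) :
    (removeVar F).eval₂ ((MvPolynomial.aeval p : MvPolynomial ℕ K →ₐ[K] L) : MvPolynomial ℕ K →+* L) z =
      MvPolynomial.aeval (fun r => p r - z ^ (r + 1)) F := by
  have : (Polynomial.eval₂RingHom ((MvPolynomial.aeval p : MvPolynomial ℕ K →ₐ[K] L) : MvPolynomial ℕ K →+* L) z).comp
      ((removeVar : MvPolynomial ℕ K →ₐ[K] _) : MvPolynomial ℕ K →+* _) =
      ((MvPolynomial.aeval fun r => p r - z ^ (r + 1) : MvPolynomial ℕ K →ₐ[K] L) :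
        MvPolynomial ℕ K →+* L) := by
    refine MvPolynomial.ringHom_ext (fun a => ?_) fun r => ?_
    · simp [removeVar, ← MvPolynomial.algebraMap_eq, Polynomial.algebraMap_apply]
    · simp [removeVar]
  exact DFunLike.congr_fun this F

/-- With every q_{m+1+k} expanded, the powers x_i^k reassemble `removeVar F` at z = x_i, that is, F
with x_i deleted. The index is positive because the expansion fails for q_0. -/
theorem evalFin_jing_succ [CharZero K] (t : K) {x : ι → L} (hx : Function.Injective x) (hx0 : ∀ i, x i ≠ 0)
    (m : ℕ) (F : MvPolynomial ℕ K) :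
    evalFin K x (jing t (m + 1) F) =
      (1 - algebraMap K L t) * ∑ i, x i ^ (m + 1) * hlCoeff (algebraMap K L t) x i *
        MvPolynomial.aeval (fun r : ℕ => ∑ j, x j ^ (r + 1) - x i ^ (r + 1)) F := by
  have hN := Nat.lt_succ_self (removeVar F).natDegree
  rw [jing_apply, pairQ_eq_sum_range _ _ _ hN, map_sum]
  simp_rw [← eval₂_removeVar, Polynomial.eval₂_eq_sum_range' _ hN, map_mul, add_right_comm m 1,
    evalFin_qFun_succ t hx hx0, Finset.mul_sum]
  rw [Finset.sum_comm]
  refine Finset.sum_congr rfl fun i _ => Finset.sum_congr rfl fun k _ => ?_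
  rw [evalFin, RingHom.coe_coe]
  ring

end PartialFractions

/-! ### The sum over the symmetric group. -/

section Symmetrization

variable {L : Type*} [Field L]

/-- The sum over the symmetric group in the Hall-Littlewood polynomial. -/
def hlSum (t : L) (f : ℕ → ℕ) {N : ℕ} (x : Fin N → L) : L :=
  ∑ w : Equiv.Perm (Fin N), (∏ k : Fin N, x (w k) ^ f k) *
    ∏ i : Fin N, ∏ j ∈ Finset.Ioi i, (x (w i) - t * x (w j)) / (x (w i) - x (w j))

theorem prod_swap_succ {M : Type*} [CommMonoid M] {N : ℕ} (p : Fin (N + 1))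
    (g : Fin (N + 1) → M) :
    ∏ k : Fin N, g (Equiv.swap 0 p k.succ) = ∏ k ∈ Finset.univ.erase p, g k := by
  refine Finset.prod_bij (fun k _ => Equiv.swap 0 p k.succ) (fun k _ => ?_)
    (fun k _ k' _ h => ?_) (fun k hk => ?_) fun k _ => rfl
  · refine Finset.mem_erase.2 ⟨fun h => Fin.succ_ne_zero k ?_, Finset.mem_univ _⟩
    exact (Equiv.swap 0 p).injective (h.trans (Equiv.swap_apply_left 0 p).symm)
  · exact Fin.succ_injective _ ((Equiv.swap 0 p).injective h)
  · have h0 : Equiv.swap 0 p k ≠ 0 := fun h => Finset.ne_of_mem_erase hk (by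
      exact (Equiv.swap 0 p).injective (h.trans (Equiv.swap_apply_right 0 p).symm))
    obtain ⟨k', hk'⟩ := Fin.exists_succ_eq.2 h0
    exact ⟨k', Finset.mem_univ _, by rw [hk', Equiv.swap_apply_self]⟩

/-- Sort the permutations by the image p of 0: the factors with i = 0 form `hlCoeff t x p`, and the
rest is the same sum in the variables other than x_p. -/
theorem hlSum_succ (t : L) (f : ℕ → ℕ) {N : ℕ} (x : Fin (N + 1) → L) :
    hlSum t f x = ∑ p, x p ^ f 0 * hlCoeff t x p *
      hlSum t (fun k => f (k + 1)) (fun k : Fin N => x (Equiv.swap 0 p k.succ)) := by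
  rw [hlSum, ← Equiv.sum_comp Equiv.Perm.decomposeFin.symm, Fintype.sum_prod_type]
  refine Finset.sum_congr rfl fun p _ => ?_
  rw [hlSum, Finset.mul_sum]
  refine Finset.sum_congr rfl fun w _ => ?_
  rw [Fin.prod_univ_succ, Fin.prod_univ_succ (fun i => ∏ j ∈ Finset.Ioi i, _),
    Fin.prod_Ioi_zero]
  simp only [Fin.prod_Ioi_succ, Equiv.Perm.decomposeFin_symm_apply_zero,
    Equiv.Perm.decomposeFin_symm_apply_succ, Fin.val_zero, Fin.val_succ]
  rw [Equiv.prod_comp w fun j => (x p - t * x (Equiv.swap 0 p j.succ)) /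
    (x p - x (Equiv.swap 0 p j.succ)), prod_swap_succ p fun k => (x p - t * x k) / (x p - x k),
    ← hlCoeff]
  ring

variable {K : Type*} [Field K] [Algebra K L]

/-- The Hall-Littlewood function, up to a scalar, with rows `f 0, …, f (l - 1)`. -/
noncomputable def rowQ (t : K) : (ℕ → ℕ) → ℕ → MvPolynomial ℕ K
  | _, 0 => 1
  | f, l + 1 => jing t (f 0) (rowQ t (fun k => f (k + 1)) l)

/-- Induction on N. A positive first row matches `evalFin_jing_succ`. Once only zero rows are left,
`sum_hlCoeff` gives a factor 1 - t^k with k variables remaining, and these build (t;t)_{N-l}. -/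
theorem pow_mul_hlSum [CharZero K] (t : K) {N l : ℕ} (hl : l ≤ N) {f : ℕ → ℕ} (hf : ∀ k < l, 0 < f k)
    (hf0 : ∀ k, l ≤ k → f k = 0) {x : Fin N → L} (hx : Function.Injective x)
    (hx0 : ∀ i, x i ≠ 0) :
    (1 - algebraMap K L t) ^ N * hlSum (algebraMap K L t) f x =
      qPoch (algebraMap K L t) (algebraMap K L t) (N - l) * evalFin K x (rowQ t f l) := by
  induction N generalizing l f with
  | zero =>
    obtain rfl : l = 0 := by omega
    simp [hlSum, rowQ, qPoch_zero]
  | succ N ih =>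
    have hx' : ∀ p, Function.Injective fun k : Fin N => x (Equiv.swap 0 p k.succ) := fun p =>
      hx.comp ((Equiv.swap 0 p).injective.comp (Fin.succ_injective _))
    have hx0' : ∀ p, ∀ k : Fin N, x (Equiv.swap 0 p k.succ) ≠ 0 := fun p k => hx0 _
    rw [hlSum_succ]
    cases l with
    | zero =>
      have h1 : ∀ p, (1 - algebraMap K L t) ^ N * hlSum (algebraMap K L t) (fun k => f (k + 1))
          (fun k : Fin N => x (Equiv.swap 0 p k.succ)) =
          qPoch (algebraMap K L t) (algebraMap K L t) N := fun p => by
        have := ih (l := 0) (Nat.zero_le N) (f := fun k => f (k + 1))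
          (fun k hk => absurd hk (Nat.not_lt_zero k)) (fun k _ => hf0 _ (Nat.zero_le _))
          (hx' p) (hx0' p)
        simpa [rowQ] using this
      have h2 := sum_hlCoeff (algebraMap K L t) hx hx0
      rw [Fintype.card_fin] at h2
      rw [rowQ, map_one, mul_one, Nat.sub_zero, qPoch_succ, ← h2, pow_succ, Finset.mul_sum,
        Finset.mul_sum, Finset.mul_sum]
      refine Finset.sum_congr rfl fun p _ => ?_
      rw [hf0 0 le_rfl, ← h1 p]
      ring
    | succ l =>
      obtain ⟨m, hm⟩ := Nat.exists_eq_succ_of_ne_zero (hf 0 (Nat.succ_pos l)).ne'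
      rw [rowQ, hm, Nat.succ_eq_add_one, evalFin_jing_succ t hx hx0, pow_succ,
        Nat.add_sub_add_right, Finset.mul_sum, Finset.mul_sum, Finset.mul_sum]
      refine Finset.sum_congr rfl fun p _ => ?_
      have h1 := ih (l := l) (by omega) (f := fun k => f (k + 1)) (fun k hk => hf _ (by omega))
        (fun k hk => hf0 _ (by omega)) (hx' p) (hx0' p)
      have h2 : (fun r : ℕ => ∑ j, x j ^ (r + 1) - x p ^ (r + 1)) =
          fun r : ℕ => ∑ k : Fin N, x (Equiv.swap 0 p k.succ) ^ (r + 1) := by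
        funext r
        rw [← Equiv.sum_comp (Equiv.swap 0 p), Fin.sum_univ_succ, Equiv.swap_apply_left]
        ring
      rw [h2]
      rw [evalFin] at h1
      linear_combination (1 - algebraMap K L t) * x p ^ (m + 1) *
        hlCoeff (algebraMap K L t) x p * h1

end Symmetrization

/-! ### Rows, columns and multiplicities of a partition. -/

section Partitions

variable (lam : YoungDiagram)

theorem lt_rowLen_iff_lt_colLen (i k : ℕ) : i < lam.rowLen k ↔ k < lam.colLen i := by
  rw [← YoungDiagram.mem_iff_lt_rowLen, YoungDiagram.mem_iff_lt_colLen]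

theorem rowLen_eq_succ_iff (i k : ℕ) :
    lam.rowLen k = i + 1 ↔ lam.colLen (i + 1) ≤ k ∧ k < lam.colLen i := by
  have h1 := lt_rowLen_iff_lt_colLen lam i k
  have h2 := lt_rowLen_iff_lt_colLen lam (i + 1) k
  omega

theorem mult_succ {N : ℕ} (hN : lam.colLen 0 ≤ N) (i : ℕ) :
    mult lam N (i + 1) = lam.colLen i - lam.colLen (i + 1) := by
  rw [mult, ← Nat.card_Ico, ← Finset.card_map Fin.valEmbedding]
  congr 1
  ext k
  have h := lam.colLen_anti 0 i (Nat.zero_le i)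
  simp only [Finset.mem_map, Finset.mem_filter, Finset.mem_univ, true_and, Finset.mem_Ico,
    rowLen_eq_succ_iff, Fin.valEmbedding_apply]
  exact ⟨fun ⟨a, ha, hak⟩ => hak ▸ ha, fun hk => ⟨⟨k, by omega⟩, hk, rfl⟩⟩

theorem mult_zero (N : ℕ) : mult lam N 0 = N - lam.colLen 0 := by
  rw [mult, ← Nat.card_Ico, ← Finset.card_map Fin.valEmbedding]
  congr 1
  ext k
  have h : ∀ a, lam.rowLen a = 0 ↔ lam.colLen 0 ≤ a := fun a => by
    have := lt_rowLen_iff_lt_colLen lam 0 a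
    omega
  simp only [Finset.mem_map, Finset.mem_filter, Finset.mem_univ, true_and, Finset.mem_Ico,
    h, Fin.valEmbedding_apply]
  exact ⟨fun ⟨a, ha, hak⟩ => hak ▸ ⟨ha, a.2⟩, fun hk => ⟨⟨k, hk.2⟩, hk.1, rfl⟩⟩

theorem mult_eq_zero {N i : ℕ} (hi : lam.rowLen 0 < i) : mult lam N i = 0 := by
  rw [mult, Finset.card_eq_zero, Finset.filter_eq_empty_iff]
  intro k _
  have := lam.rowLen_anti 0 k (Nat.zero_le _)
  omega

theorem sum_mult {m : ℕ} (hm : lam.rowLen 0 ≤ m) (N : ℕ) :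
    ∑ i ∈ Finset.range (m + 1), mult lam N i = N := by
  have := Finset.card_eq_sum_card_fiberwise (s := (Finset.univ : Finset (Fin N)))
    (t := Finset.range (m + 1)) (f := fun k : Fin N => lam.rowLen k) (fun k _ => by
      have := lam.rowLen_anti 0 k (Nat.zero_le _)
      simp only [Finset.coe_range, Set.mem_Iio]
      omega)
  rw [Finset.card_univ, Fintype.card_fin] at this
  exact this.symm

variable {K : Type*} [Field K] {lam}

theorem rowQ_eq_jing_pow (t : K) {m a l : ℕ} {f : ℕ → ℕ} (hf : ∀ k < a, f k = m) :
    rowQ t f (a + l) = (jing t m ^ a) (rowQ t (fun k => f (a + k)) l) := by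
  induction a generalizing f with
  | zero => simp
  | succ a ih =>
    rw [add_right_comm, rowQ, hf 0 (Nat.succ_pos a), ih fun k hk => hf (k + 1) (by omega),
      pow_succ', Module.End.mul_apply]
    simp only [add_right_comm a _ 1]

/-- With the first e rows discarded, the next `lam.colLen m` - e rows, in the case of m + 1 columns,
all have length m + 1; equal rows group into a power of one operator. -/
theorem rowQ_eq_columnQ (t : K) {m e : ℕ} (he : lam.colLen m ≤ e)
    (he' : ∀ i < m, e ≤ lam.colLen i) :
    rowQ t (fun k => lam.rowLen (e + k)) (lam.colLen 0 - e) = columnQ t m lam.colLen e := by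
  induction m generalizing e with
  | zero => rw [Nat.sub_eq_zero_of_le he, rowQ, columnQ]
  | succ m ih =>
    have h1 := he' m (Nat.lt_succ_self m)
    have h2 := lam.colLen_anti 0 m (Nat.zero_le m)
    rw [columnQ, ← ih le_rfl fun i hi => lam.colLen_anti i m hi.le,
      show lam.colLen 0 - e = (lam.colLen m - e) + (lam.colLen 0 - lam.colLen m) by omega,
      rowQ_eq_jing_pow t (m := m + 1) fun k hk => (rowLen_eq_succ_iff lam m _).2 (by omega)]
    congr 3
    funext k
    congr 1
    omega

end Partitions

/-! ### Existence of the Hall–Littlewood symmetric function. -/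

section Existence

variable {K : Type*} [Field K]

/-- The Hall-Littlewood symmetric function in terms of Jing operators. -/
noncomputable def jingHallLittlewood (lam : YoungDiagram) (m : ℕ) (t : K) : MvPolynomial ℕ K :=
  MvPolynomial.C (∏ i ∈ Finset.range m, 1 / qPoch t t (lam.colLen i - lam.colLen (i + 1))) *
    columnQ t m lam.colLen 0

theorem algebraMap_qPoch {L : Type*} [Field L] [Algebra K L] (t : K) (k : ℕ) :
    algebraMap K L (qPoch t t k) = qPoch (algebraMap K L t) (algebraMap K L t) k := by
  simp [qPoch]

/-- The factor (t;t)_{N-l} cancels against the multiplicity m_0, the only one depending on N, so one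
symmetric function serves all N ≥ l(λ). -/
theorem hallLittlewood_eq_evalFin [CharZero K] {L : Type*} [Field L] [Algebra K L] {t : K}
    (ht : ∀ r : ℕ, t ^ (r + 1) ≠ 1) {lam : YoungDiagram} {m : ℕ} (hm : lam.rowLen 0 ≤ m) {N : ℕ}
    (hN : lam.colLen 0 ≤ N) {x : Fin N → L} (hx : Function.Injective x) (hx0 : ∀ i, x i ≠ 0) :
    hallLittlewood lam x (algebraMap K L t) = evalFin K x (jingHallLittlewood lam m t) := by
  have hτ : ∀ r : ℕ, (algebraMap K L t) ^ (r + 1) ≠ 1 := fun r h => ht r (by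
    rw [← map_pow] at h
    exact (algebraMap K L).injective (h.trans (map_one _).symm))
  have hcm : lam.colLen m = 0 := by
    have := lt_rowLen_iff_lt_colLen lam m 0
    omega
  have h1 := pow_mul_hlSum t hN (f := lam.rowLen)
    (fun k hk => (lt_rowLen_iff_lt_colLen lam 0 k).2 hk)
    (fun k hk => by
      have := lt_rowLen_iff_lt_colLen lam 0 k
      omega) hx hx0
  have h2 := rowQ_eq_columnQ (lam := lam) t (e := 0) hcm.le fun i _ => Nat.zero_le _
  simp only [zero_add, Nat.sub_zero] at h2
  have h3 : ∏ i ∈ Finset.range (lam.rowLen 0 + 1), (1 - algebraMap K L t) ^ mult lam N i /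
      qPoch (algebraMap K L t) (algebraMap K L t) (mult lam N i) =
      ∏ i ∈ Finset.range (m + 1), (1 - algebraMap K L t) ^ mult lam N i /
      qPoch (algebraMap K L t) (algebraMap K L t) (mult lam N i) := by
    refine Finset.prod_subset (Finset.range_subset_range.2 (by omega)) fun i _ hi => ?_
    rw [Finset.mem_range, not_lt] at hi
    rw [mult_eq_zero lam (by omega), pow_zero, qPoch_zero, div_one]
  change _ * hlSum (algebraMap K L t) lam.rowLen x = _
  rw [h3, Finset.prod_div_distrib, Finset.prod_pow_eq_pow_sum, sum_mult lam hm,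
    Finset.prod_range_succ' _ m, mult_zero, jingHallLittlewood, map_mul, ← h2,
    div_mul_eq_mul_div, h1]
  have h4 : ∏ i ∈ Finset.range m, qPoch (algebraMap K L t) (algebraMap K L t)
      (mult lam N (i + 1)) ≠ 0 := Finset.prod_ne_zero_iff.2 fun i _ => qPoch_ne_zero hτ _
  have h5 : evalFin K x (MvPolynomial.C (∏ i ∈ Finset.range m,
      1 / qPoch t t (lam.colLen i - lam.colLen (i + 1)))) =
      (∏ i ∈ Finset.range m, qPoch (algebraMap K L t) (algebraMap K L t)
        (mult lam N (i + 1)))⁻¹ := by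
    rw [evalFin, MvPolynomial.aeval_C, map_prod, ← Finset.prod_inv_distrib]
    refine Finset.prod_congr rfl fun i _ => ?_
    rw [mult_succ lam hN, map_div₀, map_one, algebraMap_qPoch, one_div]
  rw [h5]
  have h6 := qPoch_ne_zero hτ (N - lam.colLen 0)
  field_simp

theorem isHallLittlewood_jingHallLittlewood [CharZero K] {t : K} (ht : ∀ r : ℕ, t ^ (r + 1) ≠ 1)
    {lam : YoungDiagram} {m : ℕ} (hm : lam.rowLen 0 ≤ m) :
    IsHallLittlewood lam t (jingHallLittlewood lam m t) := by
  intro N hN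
  have hinj := IsFractionRing.injective (MvPolynomial (Fin N) K)
    (FractionRing (MvPolynomial (Fin N) K))
  have h := hallLittlewood_eq_evalFin ht hm hN (hinj.comp MvPolynomial.X_injective)
    fun i => (map_ne_zero_iff _ hinj).2 (MvPolynomial.X_ne_zero i)
  rw [← MvPolynomial.algebraMap_eq, ← IsScalarTower.algebraMap_apply]
  refine Eq.trans ?_ h.symm
  rw [restrict, evalFin,
    MvPolynomial.map_aeval, MvPolynomial.aeval_def, MvPolynomial.coe_eval₂Hom,
    ← IsScalarTower.algebraMap_eq]
  simp [MvPolynomial.psum]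

end Existence

/-! ### Passage to infinitely many variables. -/

section Specialization

variable {K : Type*} [NormedField K]

theorem tendsto_eval_restrict {x : ℕ → K} (hx : ∀ r : ℕ, Summable fun i => x i ^ (r + 1))
    (F : MvPolynomial ℕ K) :
    Filter.Tendsto (fun N : ℕ => MvPolynomial.eval (fun i : Fin N => x i) (restrict N F))
      Filter.atTop (nhds (evalSeq x F)) := by
  have h1 : ∀ N : ℕ, MvPolynomial.eval (fun i : Fin N => x i) (restrict N F) =
      MvPolynomial.eval (fun r : ℕ => ∑ i ∈ Finset.range N, x i ^ (r + 1)) F := by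
    intro N
    have : (MvPolynomial.aeval (fun i : Fin N => x i)).comp
        (MvPolynomial.aeval fun r : ℕ => MvPolynomial.psum (Fin N) K (r + 1)) =
        (MvPolynomial.aeval fun r : ℕ => ∑ i ∈ Finset.range N, x i ^ (r + 1) :
          MvPolynomial ℕ K →ₐ[K] K) := by
      ext r
      simp [MvPolynomial.psum, Finset.sum_range]
    exact DFunLike.congr_fun this F
  simp_rw [h1]
  exact ((MvPolynomial.continuous_eval F).tendsto _).comp
    (tendsto_pi_nhds.2 fun r => (hx r).hasSum.tendsto_sum_nat)

/-- The value is the limit of the values in N variables, where F and G agree for large N. This makes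
the value independent of the choice of symmetric function, without proving F = G. -/
theorem evalSeq_eq_of_isHallLittlewood {lam : YoungDiagram} {t : K} {F G : MvPolynomial ℕ K}
    (hF : IsHallLittlewood lam t F) (hG : IsHallLittlewood lam t G) {x : ℕ → K}
    (hx : ∀ r : ℕ, Summable fun i => x i ^ (r + 1)) : evalSeq x F = evalSeq x G := by
  refine tendsto_nhds_unique (tendsto_eval_restrict hx F)
    ((tendsto_eval_restrict hx G).congr' ?_)
  filter_upwards [Filter.eventually_ge_atTop (lam.colLen 0)] with N hN
  rw [IsFractionRing.injective (MvPolynomial (Fin N) K) (FractionRing (MvPolynomial (Fin N) K))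
    ((hF N hN).trans (hG N hN).symm)]

end Specialization

end HLPrincipal

theorem lemma2p1 {K : Type*} [NormedField K] [CharZero K] (q : K) (hq : ‖q‖ < 1)
    (m n : ℕ) (hm : 0 < m) (hn : 0 < n) (lam : YoungDiagram) (hlam : lam.rowLen 0 ≤ m) :
    HLPrincipal.IsHallLittlewood lam (q ^ n) (HLPrincipal.hallLittlewoodSymm lam (q ^ n)) ∧
    HLPrincipal.evalSeq (fun i : ℕ => q ^ i) (HLPrincipal.hallLittlewoodSymm lam (q ^ n)) =
      ∑ s ∈ HLPrincipal.arrays lam m n,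
        HLPrincipal.coeffB m n s (q ^ n) * q ^ ⌊HLPrincipal.expA m n s⌋₊ := by
  have hpow : ∀ k : ℕ, k ≠ 0 → ‖q ^ k‖ < 1 := fun k hk => by
    rw [norm_pow]
    exact pow_lt_one₀ (norm_nonneg q) hq hk
  have hne : ∀ k : ℕ, k ≠ 0 → q ^ k ≠ 1 := fun k hk h => by
    have := hpow k hk
    rw [h, norm_one] at this
    exact lt_irrefl _ this
  have ht : ∀ r : ℕ, (q ^ n) ^ (r + 1) ≠ 1 := fun r => by
    rw [← pow_mul]
    exact hne _ (Nat.mul_ne_zero hn.ne' (Nat.succ_ne_zero r))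
  have hgeom : ∀ r : ℕ, HasSum (fun i : ℕ => (q ^ i) ^ (r + 1)) (1 - q ^ (r + 1))⁻¹ := fun r => by
    simp_rw [← pow_mul, mul_comm _ (r + 1), pow_mul]
    exact hasSum_geometric_of_norm_lt_one (hpow _ (Nat.succ_ne_zero r))
  have hex := HLPrincipal.isHallLittlewood_jingHallLittlewood ht hlam
  -- The chosen function is only known to satisfy the defining property; its value is then computed
  -- on the Jing model.
  have hsymm : HLPrincipal.IsHallLittlewood lam (q ^ n)
      (HLPrincipal.hallLittlewoodSymm lam (q ^ n)) := Classical.epsilon_spec ⟨_, hex⟩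
  refine ⟨hsymm, ?_⟩
  rw [HLPrincipal.evalSeq_eq_of_isHallLittlewood hsymm hex fun r => (hgeom r).summable,
    HLPrincipal.evalSeq, ← HLPrincipal.aeval_principal_columnQ hn
      (fun r => hne _ (Nat.succ_ne_zero r)) hlam]
  simp_rw [(hgeom _).tsum_eq]
  rw [HLPrincipal.jingHallLittlewood, map_mul, MvPolynomial.eval_C, MvPolynomial.aeval_eq_eval]
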